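/- **Definitions.** Let $f:\mathbb{R}^P\to\mathbb{R}$ be a cost. A *gradient flow path* of $f$ is a maximal solution $x:(-\infty,T_x)\to\mathbb{R}^P$, $T_x\in(-\infty,+\infty]$, of $\dot x(t)=-\nabla f(x(t))$. For $k\ge 2$ (the degree of the leading homogeneous part of $f$ at the origin) and $s\in\mathbb{R}$, the set $\mathcal{F}_f(s)$ of fast escaping paths with speed at least $s$ consists of the gradient flow paths $x$ of $f$ such that: if $k=2$, $\|x(t)\|=O(e^{st})$ as $t\to-\infty$; if $k>2$, there is $T\in\mathbb{R}$ with $\|x(t)\|\le\left(s(k-2)(T-t)\right)^{-1/(k-2)}$ for all small enough $t$. For a homogeneous polynomial $H$ put $\|H\|_\infty=\max_{\|\rho\|=1}|H(\rho)|$. **Theorem 3, general form.** Let $C=H+e:\mathbb{R}^P\to\mathbb{R}$ be $(k,m)$-approximately homogeneous at the origin, that is, $2\le k<m$ are integers, $H$ is a homogeneous polynomial of degree $k$, and $e$ is infinitely differentiable with all derivatives of orders $1,\dots,m-1$ vanishing at $0$. * *When $k=2$:* for all $s_0>\frac{k\|H\|_\infty}{m-1}$ there is a unique bijection $\Psi:\mathcal{F}_H(s_0)\to\mathcal{F}_C(s_0)$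 such that for all $x\in\mathcal{F}_H(s_0)$, $\|x(t)-\Psi(x)(t)\|=O(e^{(m-1)s_0t})$ as $t\to-\infty$. * *When $k>2$:* for all $s_0>\frac{k-1}{m-k+1}\,k\|H\|_\infty$ there is a unique bijection $\Psi:\mathcal{F}_H(s_0)\to\mathcal{F}_C(s_0)$ such that for all $x\in\mathcal{F}_H(s_0)$, $\|x(t)-\Psi(x)(t)\|=O\big((-t)^{-\frac{m-k+1}{k-2}}\big)$ as $t\to-\infty$. **Deep linear networks.** Let $L\ge2$, let $n_0,\dots,n_L$ be widths, let $C:\mathbb{R}^{n_L\times n_0}\to\mathbb{R}$ be twice continuously differentiable, and let $\mathcal{L}(\theta)=C(A_\theta)$ with $A_\theta=W_L\cdots W_1$ for $\theta=(W_L,\dots,W_1)$, $W_\ell\in\mathbb{R}^{n_\ell\times n_{\ell-1}}$. Let $H(\theta)=\mathrm{Tr}[\nabla C(0)^TA_\theta]$ and $s^*=L^{-\frac{L-2}{2}}s_1$, where $s_1$ is the largest singular value of $\nabla C(0)$. Then $H$ is a homogeneous polynomial of degree $L$, and $C(0)+H$ is the $L$-th order Taylor approximation of $\mathcal{L}$ at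 the origin: $\mathcal{L}(\theta)=C(0)+H(\theta)+O(\|\theta\|^{2L})$ as $\theta\to0$. Moreover, with the sets $\mathcal{F}_{\mathcal{L}}(s)$, $\mathcal{F}_H(s)$ formed with $k=L$: * *Shallow networks ($L=2$):* for all $s>\frac13s^*$ there is a unique bijection $\Psi:\mathcal{F}_{\mathcal{L}}(s)\to\mathcal{F}_H(s)$ such that for all $\theta\in\mathcal{F}_{\mathcal{L}}(s)$, $\|\theta(t)-\Psi(\theta)(t)\|=O(e^{3st})$ as $t\to-\infty$. * *Deep networks ($L>2$):* for all $s>\frac{L-1}{L+1}s^*$ there is a unique bijection $\Psi:\mathcal{F}_{\mathcal{L}}(s)\to\mathcal{F}_H(s)$ such that for all $\theta\in\mathcal{F}_{\mathcal{L}}(s)$, $\|\theta(t)-\Psi(\theta)(t)\|=O\big((-t)^{-\frac{L+1}{L-2}}\big)$ as $t\to-\infty$. -/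

import Mathlib

open Filter Asymptotics Topology
open scoped ContDiff Gradient Matrix Matrix.Norms.Frobenius

noncomputable section

/-- A gradient flow path of the cost `f` coming from `t = -∞`: a maximal solution of
`x'(t) = -∇ f (x t)` on an open interval `(-∞, endTime)`, where `endTime ∈ (-∞, +∞]` is the
(possibly infinite) explosion time. Values at times `t ≥ endTime` carry no meaning and are set
to `0`, so that two paths are equal exactly when they are equal as partially defined functions. -/
structure GradientFlowPath {E : Type*} [NormedAddCommGroup E] [InnerProductSpace ℝ E]
    [CompleteSpace E] (f : E → ℝ) where
  /-- the path -/
  toFun : ℝ → E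
  /-- the explosion time -/
  endTime : EReal
  bot_lt_endTime : ⊥ < endTime
  hasDerivAt : ∀ t : ℝ, (t : EReal) < endTime → HasDerivAt toFun (-∇ f (toFun t)) t
  eq_zero_of_le : ∀ t : ℝ, endTime ≤ (t : EReal) → toFun t = 0
  maximal : ∀ (T : EReal) (y : ℝ → E), endTime < T →
    (∀ t : ℝ, (t : EReal) < T → HasDerivAt y (-∇ f (y t)) t) →
    ¬ ∀ t : ℝ, (t : EReal) < endTime → y t = toFun t

instance {E : Type*} [NormedAddCommGroup E] [InnerProductSpace ℝ E] [CompleteSpace E]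
    (f : E → ℝ) : CoeFun (GradientFlowPath f) (fun _ => ℝ → E) :=
  ⟨GradientFlowPath.toFun⟩

/-- The set `F_f(s)` of gradient flow paths of `f` that escape the origin with speed at least `s`,
where `k` is the degree of the leading homogeneous part of `f` at the origin:
* `k = 2`: `‖x t‖ = O(e^{s t})` as `t → -∞`;
* otherwise (`k > 2`): `‖x t‖ ≤ (s (k - 2) (T - t))^{-1 / (k - 2)}` for some `T` and all small
  enough `t`. -/
def fastEscapePaths {E : Type*} [NormedAddCommGroup E] [InnerProductSpace ℝ E] [CompleteSpace E]
    (f : E → ℝ) (k : ℕ) (s : ℝ) : Set (GradientFlowPath f) :=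
  {x | if k = 2 then (fun t => x t) =O[atBot] (fun t => Real.exp (s * t))
    else ∃ T : ℝ, ∀ᶠ t in atBot,
      ‖x t‖ ≤ (s * ((k : ℝ) - 2) * (T - t)) ^ (-(1 / ((k : ℝ) - 2)))}

/-- `H` is (the function given by) a homogeneous polynomial of degree `k`. -/
def IsHomogeneousPolynomial {ι : Type*} (k : ℕ) (H : EuclideanSpace ℝ ι → ℝ) : Prop :=
  ∃ p : MvPolynomial ι ℝ, p.IsHomogeneous k ∧ ∀ θ, H θ = MvPolynomial.eval (fun i => θ i) p

/-- `‖H‖_∞`, the maximum of `|H|` over the Euclidean unit sphere. -/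
def sphereNorm {ι : Type*} [Fintype ι] (H : EuclideanSpace ℝ ι → ℝ) : ℝ :=
  ⨆ ρ : Metric.sphere (0 : EuclideanSpace ℝ ι) 1, |H ρ|

/-- `C = H + e` is `(k, m)`-approximately homogeneous at the origin, with `H` a polynomial:
`2 ≤ k < m`, `H` is a homogeneous polynomial of degree `k`, and `e` is infinitely differentiable
with vanishing derivatives of orders `1, …, m - 1` at the origin. -/
structure IsApproxHomogeneous {ι : Type*} [Fintype ι] (k m : ℕ)
    (C H e : EuclideanSpace ℝ ι → ℝ) : Prop where
  two_le : 2 ≤ k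
  lt : k < m
  eq_add : ∀ θ, C θ = H θ + e θ
  homogeneous : IsHomogeneousPolynomial k H
  smooth : ContDiff ℝ ∞ e
  deriv_eq_zero : ∀ j : ℕ, 1 ≤ j → j < m → iteratedFDeriv ℝ j e 0 = 0

/-! ### Deep linear networks -/

/-- The parameter space `ℝ^P`, `P = ∑ n_{ℓ-1} n_ℓ`, of the deep linear network of depth `L` and
widths `n 0, …, n L`, with the Euclidean norm. -/
abbrev DLNParam (L : ℕ) (n : ℕ → ℕ) : Type :=
  EuclideanSpace ℝ (Σ ℓ : Fin L, Fin (n (ℓ + 1)) × Fin (n ℓ))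

/-- The `n (ℓ + 1) × n ℓ` weight matrix of layer `ℓ` (layers are counted from `0`). -/
def weight {L : ℕ} {n : ℕ → ℕ} (θ : DLNParam L n) (ℓ : Fin L) :
    Matrix (Fin (n (ℓ + 1))) (Fin (n ℓ)) ℝ :=
  Matrix.of fun i j => θ ⟨ℓ, (i, j)⟩

/-- The product of the first `ℓ` weight matrices. -/
def partialProd {L : ℕ} {n : ℕ → ℕ} (θ : DLNParam L n) :
    (ℓ : ℕ) → ℓ ≤ L → Matrix (Fin (n ℓ)) (Fin (n 0)) ℝ
  | 0, _ => 1
  | ℓ + 1, h => weight θ ⟨ℓ, h⟩ * partialProd θ ℓ (Nat.le_of_succ_le h)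

/-- The network matrix `A_θ = W_L ⋯ W_1`. -/
def networkMatrix {L : ℕ} {n : ℕ → ℕ} (θ : DLNParam L n) : Matrix (Fin (n L)) (Fin (n 0)) ℝ :=
  partialProd θ L le_rfl

/-- The loss `θ ↦ C(A_θ)`. -/
def dlnLoss (L : ℕ) (n : ℕ → ℕ) (C : Matrix (Fin (n L)) (Fin (n 0)) ℝ → ℝ) :
    DLNParam L n → ℝ :=
  fun θ => C (networkMatrix θ)

/-- The gradient matrix `∇C(0)`, whose entries are the partial derivatives of `C` at `0`. -/
def gradAtZero {a b : ℕ} (C : Matrix (Fin a) (Fin b) ℝ → ℝ) : Matrix (Fin a) (Fin b) ℝ :=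
  Matrix.of fun i j => fderiv ℝ C 0 (Matrix.single i j 1)

/-- The leading part `H(θ) = Tr(∇C(0)ᵀ A_θ)` of the loss at the origin. -/
def dlnLeading (L : ℕ) (n : ℕ → ℕ) (C : Matrix (Fin (n L)) (Fin (n 0)) ℝ → ℝ) :
    DLNParam L n → ℝ :=
  fun θ => ((gradAtZero C)ᵀ * networkMatrix θ).trace

/-- The optimal escape speed `s* = L^{-(L-2)/2} s₁`, with `s₁` the largest singular value of
`∇C(0)`. -/
def optimalSpeed (L : ℕ) (n : ℕ → ℕ) (C : Matrix (Fin (n L)) (Fin (n 0)) ℝ → ℝ) : ℝ :=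
  (L : ℝ) ^ (-(((L : ℝ) - 2) / 2)) * (Matrix.toEuclideanLin (gradAtZero C)).singularValues 0

end

/-! ### Integral equations on a half-line -/

/-! Write `k = j + 2` and `M = m - k + 1`. Up to a time shift, escaping with speed `s` means staying
below a profile `p → 0` with `p' = s p ^ (j + 1)`: an exponential if `j = 0`, a negative power of
`-t` otherwise. Given such a path `x` of one flow `x' = u(x)`, a path `y = x + z` of the other flow
`v` requires `z' = v(x + z) - u(x)`. The fields differ by `O(‖x‖ ^ (j + M))`, `v` has Lipschitz
constant about `c p ^ j` at radius `p`, and `(p ^ M)' = M s p ^ (j + M)`. So integration from `-∞`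
contracts the norm `sup ‖z‖ / p ^ M` with factor about `c / (M s)`, and `c < M s` is the condition
on the speed. This gives existence (`exists_asymptotic_solution`); iterating the same estimate on
the difference of two candidates gives uniqueness (`eventually_eq_of_asymptotic`).

The new path must have the same speed. If `M ≥ j + 1`, a time shift of `p` absorbs the correction `R
p ^ M`. If `M < j + 1`, the condition on `s` even forces `s > k ‖H‖_∞`; then no nonzero path escapes
that fast and both sets contain only the zero path.

The relation `x - y = O(p ^ M)` is symmetric in the two costs, so unique partners in both directions
yield the bijection and its uniqueness.

For homogeneous `H` the constant is `c = (k - 1) k ‖H‖_∞`, plus arbitrarily little for the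
remainder. It rests on Banach's theorem, by which the symmetric form of `H` has norm at most
`‖H‖_∞`. For networks, `A_θ` is the diagonal of an `L`-linear map and `C` is `C²`, so the remainder
behaves as with `m = 2 L`, that is `M = L + 1`; AM-GM gives `L ‖H‖_∞ ≤ s*`. -/

theorem integral_le_of_hasDerivAt {w w' : ℝ → ℝ} {t₀ s t c : ℝ} (hw : Continuous w)
    (hw' : Continuous w') (hd : ∀ t < t₀, HasDerivAt w (w' t) t) (h0 : ∀ t ≤ t₀, 0 ≤ w t)
    (hc : 0 ≤ c) (hst : s ≤ t) (ht : t ≤ t₀) : ∫ r in s..t, c * w' r ≤ c * w t := by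
  rw [intervalIntegral.integral_const_mul,
    intervalIntegral.integral_eq_sub_of_hasDerivAt_of_le hst hw.continuousOn
      (fun r hr => hd r (hr.2.trans_le ht)) (hw'.intervalIntegrable _ _)]
  have := h0 s (hst.trans ht)
  gcongr
  linarith

theorem integrableOn_Iic_of_norm_le_deriv {E : Type*} [NormedAddCommGroup E] {g : ℝ → E} {w w' : ℝ → ℝ} {t₀ c : ℝ}
    (hg : Continuous g) (hw : Continuous w) (hw' : Continuous w')
    (hd : ∀ t < t₀, HasDerivAt w (w' t) t) (h0 : ∀ t ≤ t₀, 0 ≤ w t) (hc : 0 ≤ c)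
    (hb : ∀ t ≤ t₀, ‖g t‖ ≤ c * w' t) (t : ℝ) : MeasureTheory.IntegrableOn g (Set.Iic t) := by
  have h1 : MeasureTheory.IntegrableOn g (Set.Iic t₀) := by
    refine MeasureTheory.integrableOn_Iic_of_intervalIntegral_norm_bounded (l := atBot)
      (a := fun i => i) (c * w t₀) t₀ (fun i => ?_) tendsto_id ?_
    · exact (hg.integrableOn_Icc (a := i) (b := t₀)).mono_set Set.Ioc_subset_Icc_self
    · filter_upwards [eventually_le_atBot t₀] with i hi
      refine le_trans ?_ (integral_le_of_hasDerivAt hw hw' hd h0 hc hi le_rfl)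
      refine intervalIntegral.integral_mono_on hi (hg.norm.intervalIntegrable _ _)
        ((hw'.const_mul c).intervalIntegrable _ _) fun r hr => hb r hr.2
  have h2 : MeasureTheory.IntegrableOn g (Set.Icc t₀ t) := hg.integrableOn_Icc
  refine (h1.union h2).mono_set fun r hr => ?_
  rcases le_total r t₀ with h | h
  · exact Or.inl h
  · exact Or.inr ⟨h, hr⟩

section HalfLine

variable {E : Type*} [NormedAddCommGroup E] [NormedSpace ℝ E]

theorem norm_integral_Iic_le_of_norm_le_deriv {g : ℝ → E} {w w' : ℝ → ℝ} {t₀ c : ℝ}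
    (hg : Continuous g) (hw : Continuous w) (hw' : Continuous w')
    (hd : ∀ t < t₀, HasDerivAt w (w' t) t) (h0 : ∀ t ≤ t₀, 0 ≤ w t) (hc : 0 ≤ c)
    (hb : ∀ t ≤ t₀, ‖g t‖ ≤ c * w' t) {t : ℝ} (ht : t ≤ t₀) :
    ‖∫ r in Set.Iic t, g r‖ ≤ c * w t := by
  have hi := integrableOn_Iic_of_norm_le_deriv hg hw hw' hd h0 hc hb t
  have hl := MeasureTheory.intervalIntegral_tendsto_integral_Iic t hi (tendsto_id (α := ℝ))
  refine le_of_tendsto hl.norm ?_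
  filter_upwards [eventually_le_atBot t] with i hi
  refine le_trans ?_ (integral_le_of_hasDerivAt hw hw' hd h0 hc hi ht)
  refine (intervalIntegral.norm_integral_le_integral_norm hi).trans ?_
  exact intervalIntegral.integral_mono_on hi (hg.norm.intervalIntegrable _ _)
        ((hw'.const_mul c).intervalIntegrable _ _) fun r hr => hb r (hr.2.trans ht)

theorem hasDerivAt_integral_Iic [CompleteSpace E] {g : ℝ → E} (hg : Continuous g)
    (hi : ∀ t, MeasureTheory.IntegrableOn g (Set.Iic t)) (t : ℝ) :
    HasDerivAt (fun t => ∫ r in Set.Iic t, g r) (g t) t := by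
  have h1 : (fun t => ∫ r in Set.Iic t, g r) =
      fun t => (∫ r in Set.Iic 0, g r) + ∫ r in (0 : ℝ)..t, g r := by
    ext t
    rw [← intervalIntegral.integral_Iic_sub_Iic (hi 0) (hi t)]
    abel
  rw [h1]
  exact (intervalIntegral.integral_hasDerivAt_right (hg.intervalIntegrable _ _)
    hg.aestronglyMeasurable.stronglyMeasurableAtFilter hg.continuousAt).const_add _

/-- Picard iteration from `t = -∞` in the ball of radius `R` for the norm `sup ‖z t‖ / w t`. -/
theorem exists_hasDerivAt_of_contracting_atBot [CompleteSpace E] {G : ℝ → E → E} {w w' : ℝ → ℝ}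
    {t₀ R l : ℝ} (hG : Continuous (Function.uncurry G)) (hw : Continuous w)
    (hw' : Continuous w') (hd : ∀ t < t₀, HasDerivAt w (w' t) t) (hpos : ∀ t ≤ t₀, 0 < w t)
    (hR : 0 ≤ R) (hl0 : 0 ≤ l) (hl : l < 1)
    (hG0 : ∀ t ≤ t₀, ‖G t 0‖ ≤ (1 - l) * R * w' t)
    (hLip : ∀ t ≤ t₀, ∀ z₁ z₂ : E, ‖z₁‖ ≤ R * w t → ‖z₂‖ ≤ R * w t →
      ‖G t z₁ - G t z₂‖ * w t ≤ l * w' t * ‖z₁ - z₂‖) :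
    ∃ z : ℝ → E, (∀ t < t₀, HasDerivAt z (G t (z t)) t) ∧ ∀ t ≤ t₀, ‖z t‖ ≤ R * w t := by
  -- The unknown is `u = z / w`, which turns the weighted norm into the sup norm on a complete ball.
  let X := BoundedContinuousFunction ℝ E
  let B := Metric.closedBall (0 : X) R
  let g : B → ℝ → E := fun u s => G s (w s • u.1 s)
  have hgc : ∀ u, Continuous (g u) := fun u =>
    hG.comp (continuous_id.prodMk (hw.smul u.1.continuous))
  have hub : ∀ (u : B) s, ‖u.1 s‖ ≤ R := fun u s =>
    (u.1.norm_coe_le_norm s).trans (mem_closedBall_zero_iff.1 u.2)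
  have hwu : ∀ (u : B) s, s ≤ t₀ → ‖w s • u.1 s‖ ≤ R * w s := fun u s hs => by
    rw [norm_smul, Real.norm_of_nonneg (hpos s hs).le, mul_comm]
    exact mul_le_mul_of_nonneg_right (hub u s) (hpos s hs).le
  have hdiff : ∀ (u₁ u₂ : B) s, s ≤ t₀ → ‖g u₁ s - g u₂ s‖ ≤ l * dist u₁ u₂ * w' s := by
    intro u₁ u₂ s hs
    have h1 := hLip s hs _ _ (hwu u₁ s hs) (hwu u₂ s hs)
    rw [← smul_sub, norm_smul, Real.norm_of_nonneg (hpos s hs).le] at h1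
    have h2 : ‖g u₁ s - g u₂ s‖ ≤ l * w' s * ‖u₁.1 s - u₂.1 s‖ := by
      refine le_of_mul_le_mul_right (h1.trans_eq ?_) (hpos s hs)
      ring
    have h3 : ‖u₁.1 s - u₂.1 s‖ ≤ dist u₁ u₂ := by
      rw [← dist_eq_norm]
      exact BoundedContinuousFunction.dist_coe_le_dist s
    by_cases hw0 : 0 ≤ w' s
    · calc _ ≤ _ := h2
        _ ≤ l * w' s * dist u₁ u₂ := by gcongr
        _ = _ := by ring
    -- The sign of `w'` is not assumed. Where it is negative, `hG0` forces `R = 0`, and the ball is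
    -- a single point.
    · have : l * w' s * R ≤ 0 := by
        have := mul_nonneg (mul_nonneg hl0 (le_of_lt (by simpa using hw0 : 0 < -w' s))) hR
        nlinarith
      have h4 : 0 ≤ (1 - l) * R * w' s := (norm_nonneg _).trans (hG0 s hs)
      have h5 : R = 0 := by
        by_contra hne
        have : 0 < R := lt_of_le_of_ne hR (Ne.symm hne)
        have h6 : 0 < (1 - l) * R := mul_pos (by linarith) this
        have : 0 ≤ w' s := nonneg_of_mul_nonneg_right h4 h6
        exact hw0 this
      have h7 : u₁ = u₂ := by
        ext s
        have a1 := hub u₁ s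
        have a2 := hub u₂ s
        rw [h5] at a1 a2
        rw [norm_le_zero_iff.1 a1, norm_le_zero_iff.1 a2]
      subst h7
      simp
  have hgb : ∀ (u : B) s, s ≤ t₀ → ‖g u s‖ ≤ R * w' s := by
    intro u s hs
    have h0 : (0 : X) ∈ B := by simpa [B] using hR
    have h1 := hdiff u ⟨0, h0⟩ s hs
    have h2 : g ⟨0, h0⟩ s = G s 0 := congrArg (G s) (smul_zero (w s))
    have h3 := hG0 s hs
    rw [h2] at h1
    have h4 : dist u ⟨0, h0⟩ ≤ R := u.2
    have h5 : 0 ≤ w' s ∨ R = 0 := by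
      by_cases hR0 : R = 0
      · exact Or.inr hR0
      · left
        have : 0 < R := lt_of_le_of_ne hR (Ne.symm hR0)
        exact nonneg_of_mul_nonneg_right ((norm_nonneg _).trans h3) (mul_pos (by linarith) this)
    have h6 : l * dist u ⟨0, h0⟩ * w' s ≤ l * R * w' s := by
      rcases h5 with h5 | h5
      · gcongr
      · have : dist u ⟨0, h0⟩ = 0 := le_antisymm (h5 ▸ h4) dist_nonneg
        rw [this, h5]
    calc ‖g u s‖ ≤ ‖g u s - G s 0‖ + ‖G s 0‖ := by
          simpa using norm_add_le (g u s - G s 0) (G s 0)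
      _ ≤ l * R * w' s + (1 - l) * R * w' s := by linarith
      _ = R * w' s := by ring
  have hint : ∀ u t, MeasureTheory.IntegrableOn (g u) (Set.Iic t) := fun u t =>
    integrableOn_Iic_of_norm_le_deriv (hgc u) hw hw' hd (fun t ht => (hpos t ht).le) hR
      (hgb u) t
  let J : B → ℝ → E := fun u t => ∫ r in Set.Iic t, g u r
  have hJd : ∀ u t, HasDerivAt (J u) (g u t) t := fun u t =>
    hasDerivAt_integral_Iic (hgc u) (hint u) t
  have hJb : ∀ u t, t ≤ t₀ → ‖J u t‖ ≤ R * w t := fun u t ht =>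
    norm_integral_Iic_le_of_norm_le_deriv (hgc u) hw hw' hd (fun t ht => (hpos t ht).le) hR
      (hgb u) ht
  have hJdiff : ∀ u₁ u₂ t, t ≤ t₀ → ‖J u₁ t - J u₂ t‖ ≤ l * dist u₁ u₂ * w t := by
    intro u₁ u₂ t ht
    rw [← MeasureTheory.integral_sub (hint u₁ t) (hint u₂ t)]
    exact norm_integral_Iic_le_of_norm_le_deriv ((hgc u₁).sub (hgc u₂)) hw hw' hd
      (fun t ht => (hpos t ht).le) (by positivity) (hdiff u₁ u₂) ht
  have hmin : ∀ t, 0 < w (min t t₀) := fun t => hpos _ (min_le_right _ _)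
  have hquot : ∀ (a : E) (c t : ℝ), ‖a‖ ≤ c * w (min t t₀) → ‖(w (min t t₀))⁻¹ • a‖ ≤ c := by
    intro a c t h
    rw [norm_smul, norm_inv, Real.norm_of_nonneg (hmin t).le, inv_mul_le_iff₀ (hmin t), mul_comm]
    exact h
  -- Freezing the time at `t₀` keeps the quotient bounded and continuous on the whole line, since
  -- `w` is positive only up to `t₀`.
  let F : B → ℝ → E := fun u t => (w (min t t₀))⁻¹ • J u (min t t₀)
  have hFc : ∀ u, Continuous (F u) := by
    intro u
    have hJc : Continuous (J u) := continuous_iff_continuousAt.2 fun t => (hJd u t).continuousAt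
    have hm : Continuous fun t : ℝ => min t t₀ := continuous_id.min continuous_const
    exact ((hw.comp hm).inv₀ fun t => (hmin t).ne').smul (hJc.comp hm)
  have hFb : ∀ u t, ‖F u t‖ ≤ R := fun u t => hquot _ _ _ (hJb u _ (min_le_right _ _))
  let Φ : B → B := fun u => ⟨BoundedContinuousFunction.ofNormedAddCommGroup (F u) (hFc u) R (hFb u),
    by
      rw [mem_closedBall_zero_iff]
      exact BoundedContinuousFunction.norm_ofNormedAddCommGroup_le _ hR _⟩
  have hΦ : ContractingWith ⟨l, hl0⟩ Φ := by
    refine ⟨by exact_mod_cast hl, LipschitzWith.of_dist_le_mul fun u₁ u₂ => ?_⟩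
    refine (BoundedContinuousFunction.dist_le (mul_nonneg hl0 dist_nonneg)).2 fun t => ?_
    change dist (F u₁ t) (F u₂ t) ≤ _
    rw [dist_eq_norm, ← smul_sub]
    exact hquot _ _ _ (hJdiff u₁ u₂ _ (min_le_right _ _))
  have : CompleteSpace B := Metric.isClosed_closedBall.completeSpace_coe
  have : Nonempty B := ⟨⟨0, by simpa [B] using hR⟩⟩
  let u := ContractingWith.fixedPoint Φ hΦ
  have hu : ∀ t ≤ t₀, w t • u.1 t = J u t := by
    intro t ht
    have h1 : Φ u = u := hΦ.fixedPoint_isFixedPt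
    have h2 : u.1 t = F u t := by
      conv_lhs => rw [← h1]
      rfl
    rw [h2]
    simp only [F, min_eq_left ht]
    rw [smul_inv_smul₀ (hpos t ht).ne']
  refine ⟨J u, fun t ht => ?_, hJb u⟩
  have := hJd u t
  simp only [g] at this
  rwa [hu t ht.le] at this

/-- A function which improves every bound by a multiple of `w` vanishes. -/
theorem eq_zero_of_norm_deriv_le_atBot {d d' : ℝ → E} {w w' : ℝ → ℝ} {t₀ l D : ℝ}
    (hd : ∀ t ≤ t₀, HasDerivAt d (d' t) t) (hw : ∀ t ≤ t₀, HasDerivAt w (w' t) t)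
    (hlim : Tendsto w atBot (𝓝 0)) (hl0 : 0 ≤ l) (hl : l < 1)
    (hD : 0 ≤ D) (hdw : ∀ t ≤ t₀, ‖d t‖ ≤ D * w t)
    (himp : ∀ C, 0 ≤ C → C ≤ D → (∀ t ≤ t₀, ‖d t‖ ≤ C * w t) → ∀ t ≤ t₀, ‖d' t‖ ≤ l * C * w' t) :
    ∀ t ≤ t₀, d t = 0 := by
  -- The mean value inequality on `[s, t]` with `s → -∞`, where both `d` and `w` vanish, improves
  -- `C` to `l * C`; iteration then leaves only zero.
  have step : ∀ C, 0 ≤ C → C ≤ D → (∀ t ≤ t₀, ‖d t‖ ≤ C * w t) →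
      ∀ t ≤ t₀, ‖d t‖ ≤ l * C * w t := by
    intro C hC hCD h t ht
    have hb := himp C hC hCD h
    have h1 : ∀ s ≤ t, ‖d t - d s‖ ≤ l * C * (w t - w s) := by
      intro s hs
      refine image_norm_le_of_norm_deriv_right_le_deriv_boundary' (a := s) (b := t)
        (f := fun r => d r - d s) (f' := d') (B := fun r => l * C * (w r - w s))
        (B' := fun r => l * C * w' r) ?_ ?_ ?_ ?_ ?_ ?_ ⟨hs, le_rfl⟩
      · exact fun r hr =>
          ((hd r (hr.2.trans ht)).sub_const _).continuousAt.continuousWithinAt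
      · exact fun r hr => ((hd r (hr.2.le.trans ht)).sub_const _).hasDerivWithinAt
      · simp
      · exact fun r hr => (((hw r (hr.2.trans ht)).sub_const _).const_mul
          _).continuousAt.continuousWithinAt
      · exact fun r hr => (((hw r (hr.2.le.trans ht)).sub_const _).const_mul _).hasDerivWithinAt
      · exact fun r hr => hb r (hr.2.le.trans ht)
    have hdlim : Tendsto d atBot (𝓝 0) := by
      refine squeeze_zero_norm' ?_ (by simpa using hlim.const_mul C)
      filter_upwards [eventually_le_atBot t₀] with s hs using h s hs
    have h2 : Tendsto (fun s => ‖d t - d s‖) atBot (𝓝 ‖d t - 0‖) :=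
      (tendsto_const_nhds.sub hdlim).norm
    have h3 : Tendsto (fun s => l * C * (w t - w s)) atBot (𝓝 (l * C * (w t - 0))) :=
      (tendsto_const_nhds.sub hlim).const_mul _
    have := le_of_tendsto_of_tendsto h2 h3
      ((eventually_le_atBot t).mono fun s hs => h1 s hs)
    simpa using this
  have hn : ∀ n : ℕ, ∀ t ≤ t₀, ‖d t‖ ≤ l ^ n * D * w t := by
    intro n
    induction n with
    | zero => simpa using hdw
    | succ n ih =>
      have h1 : l ^ n * D ≤ D := mul_le_of_le_one_left hD (pow_le_one₀ hl0 hl.le)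
      intro t ht
      refine (step _ (by positivity) h1 ih t ht).trans_eq ?_
      ring
  intro t ht
  have h1 : Tendsto (fun n : ℕ => l ^ n * D * w t) atTop (𝓝 (0 * D * w t)) :=
    ((tendsto_pow_atTop_nhds_zero_of_lt_one hl0 hl).mul_const _).mul_const _
  have := ge_of_tendsto' h1 fun n => hn n t ht
  simpa using this

end HalfLine

/-! ### Gradient flow paths: uniqueness and maximal extension -/

section Paths

variable {E : Type*} [NormedAddCommGroup E]

/-- `v` is Lipschitz on bounded sets. -/
def LipschitzOnBounded (v : E → E) : Prop :=
  ∀ r : ℝ, ∃ K : NNReal, LipschitzOnWith K v (Metric.closedBall 0 r)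

theorem LipschitzOnBounded.neg {v : E → E} (hv : LipschitzOnBounded v) :
    LipschitzOnBounded fun x => -v x := fun r => by
  obtain ⟨K, hK⟩ := hv r
  exact ⟨K, fun x hx y hy => by simpa [edist_neg_neg] using hK hx hy⟩

theorem LipschitzOnBounded.continuous {v : E → E} (hv : LipschitzOnBounded v) : Continuous v := by
  refine continuous_iff_continuousAt.2 fun x => ?_
  obtain ⟨K, hK⟩ := hv (‖x‖ + 1)
  exact hK.continuousOn.continuousAt (Metric.closedBall_mem_nhds_of_mem (by simp))

variable [InnerProductSpace ℝ E]

/-- On the compact interval `[t₀ - 1, t]` both solutions stay in a common ball, where `v` is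
Lipschitz, so Grönwall applies from the time `t₀ - 1` at which they agree. -/
theorem eq_of_eq_of_lt {v : E → E} (hv : LipschitzOnBounded v) {y₁ y₂ : ℝ → E} {T : EReal}
    {t₀ : ℝ} (h₁ : ∀ t : ℝ, (t : EReal) < T → HasDerivAt y₁ (v (y₁ t)) t)
    (h₂ : ∀ t : ℝ, (t : EReal) < T → HasDerivAt y₂ (v (y₂ t)) t)
    (heq : ∀ t < t₀, y₁ t = y₂ t) {t : ℝ} (ht : (t : EReal) < T) : y₁ t = y₂ t := by
  rcases lt_or_ge t t₀ with h | h
  · exact heq t h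
  have hlt : ∀ r ∈ Set.Icc (t₀ - 1) t, (r : EReal) < T := fun r hr =>
    (EReal.coe_le_coe_iff.2 hr.2).trans_lt ht
  have hc₁ : ContinuousOn y₁ (Set.Icc (t₀ - 1) t) := fun r hr =>
    (h₁ r (hlt r hr)).continuousAt.continuousWithinAt
  have hc₂ : ContinuousOn y₂ (Set.Icc (t₀ - 1) t) := fun r hr =>
    (h₂ r (hlt r hr)).continuousAt.continuousWithinAt
  obtain ⟨r₁, hr₁⟩ := isCompact_Icc.exists_bound_of_continuousOn hc₁
  obtain ⟨r₂, hr₂⟩ := isCompact_Icc.exists_bound_of_continuousOn hc₂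
  obtain ⟨K, hK⟩ := hv (max r₁ r₂)
  refine ODE_solution_unique_of_mem_Icc_right (v := fun _ => v)
    (s := fun _ => Metric.closedBall 0 (max r₁ r₂)) (a := t₀ - 1) (b := t)
    (fun _ _ => hK) hc₁ (fun r hr => (h₁ r (hlt r ⟨hr.1, hr.2.le⟩)).hasDerivWithinAt)
    (fun r hr => ?_) hc₂ (fun r hr => (h₂ r (hlt r ⟨hr.1, hr.2.le⟩)).hasDerivWithinAt)
    (fun r hr => ?_) (heq _ (by linarith)) ⟨by linarith, le_rfl⟩
  · simpa using Or.inl (hr₁ r ⟨hr.1, hr.2.le⟩)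
  · simpa using Or.inr (hr₂ r ⟨hr.1, hr.2.le⟩)

variable [CompleteSpace E]

/-- Agreement near `-∞` spreads to the shorter interval of definition; maximality then excludes
distinct end times, and beyond the end time both values are `0` by convention. -/
theorem GradientFlowPath.eq_of_eventuallyEq {f : E → ℝ} (hf : LipschitzOnBounded (∇ f))
    {x₁ x₂ : GradientFlowPath f} (h : ∀ᶠ t in atBot, x₁ t = x₂ t) : x₁ = x₂ := by
  obtain ⟨t₀, ht₀⟩ := eventually_atBot.1 h
  have key : ∀ x₁ x₂ : GradientFlowPath f, (∀ t < t₀, x₁ t = x₂ t) →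
      x₁.endTime ≤ x₂.endTime → x₁ = x₂ := by
    intro x₁ x₂ h hle
    have hag : ∀ t : ℝ, (t : EReal) < x₁.endTime → x₂ t = x₁ t := fun t ht =>
      eq_of_eq_of_lt hf.neg (fun t ht => x₂.hasDerivAt t (ht.trans_le hle)) x₁.hasDerivAt
        (fun t ht => (h t ht).symm) ht
    have he : x₁.endTime = x₂.endTime := by
      refine hle.eq_of_not_lt fun hlt => ?_
      exact x₁.maximal x₂.endTime x₂ hlt x₂.hasDerivAt hag
    have hfun : x₁.toFun = x₂.toFun := by
      ext t
      rcases lt_or_ge (t : EReal) x₁.endTime with ht | ht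
      · exact (hag t ht).symm
      · rw [x₁.eq_zero_of_le t ht, x₂.eq_zero_of_le t (he ▸ ht)]
    cases x₁
    cases x₂
    simp only at he hfun
    subst he hfun
    rfl
  rcases le_total x₁.endTime x₂.endTime with hle | hle
  · exact key _ _ (fun t ht => ht₀ t ht.le) hle
  · exact (key _ _ (fun t ht => (ht₀ t ht.le).symm) hle).symm

/-- All extensions of `y` agree where they overlap, so they glue to a solution up to the supremum of
their end times. Maximality holds by the choice of the supremum, without any local existence
theorem. -/
theorem exists_gradientFlowPath {f : E → ℝ} (hf : LipschitzOnBounded (∇ f)) {y : ℝ → E} {t₀ : ℝ}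
    (hy : ∀ t < t₀, HasDerivAt y (-∇ f (y t)) t) :
    ∃ x : GradientFlowPath f, ∀ t < t₀, x t = y t := by
  classical
  let P : EReal → (ℝ → E) → Prop := fun T z =>
    (∀ t : ℝ, (t : EReal) < T → HasDerivAt z (-∇ f (z t)) t) ∧ ∀ t < t₀, z t = y t
  let S : Set EReal := {T | ∃ z, P T z}
  have hS : (t₀ : EReal) ∈ S :=
    ⟨y, fun t ht => hy t (EReal.coe_lt_coe_iff.1 ht), fun _ _ => rfl⟩
  have hex : ∀ t : ℝ, (t : EReal) < sSup S → ∃ z, ∃ T : EReal, (t : EReal) < T ∧ P T z := by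
    intro t ht
    obtain ⟨T, ⟨z, hz⟩, hT⟩ := lt_sSup_iff.1 ht
    exact ⟨z, T, hT, hz⟩
  choose! Z τ hZ using hex
  let X : ℝ → E := fun t => if (t : EReal) < sSup S then Z t t else 0
  have hX : ∀ T z, P T z → ∀ t : ℝ, (t : EReal) < T → X t = z t := by
    intro T z hz t ht
    have hlt : (t : EReal) < sSup S := ht.trans_le (le_sSup ⟨z, hz⟩)
    obtain ⟨hτ, h1, h2⟩ := hZ t hlt
    simp only [X, if_pos hlt]
    exact eq_of_eq_of_lt (T := min T (τ t)) hf.neg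
      (fun r hr => h1 r (hr.trans_le (min_le_right _ _)))
      (fun r hr => hz.1 r (hr.trans_le (min_le_left _ _)))
      (fun r hr => (h2 r hr).trans (hz.2 r hr).symm) (lt_min ht hτ)
  have hXd : ∀ t : ℝ, (t : EReal) < sSup S → HasDerivAt X (-∇ f (X t)) t := by
    intro t ht
    obtain ⟨hτ, hz⟩ := hZ t ht
    have hev : X =ᶠ[𝓝 t] Z t := by
      have : ∀ᶠ r : ℝ in 𝓝 t, (r : EReal) < τ t :=
        continuous_coe_real_ereal.continuousAt.eventually (eventually_lt_nhds hτ)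
      exact this.mono fun r hr => hX _ _ hz r hr
    rw [hX _ _ hz t hτ]
    exact (hz.1 t hτ).congr_of_eventuallyEq hev
  have hXy : ∀ t < t₀, X t = y t := fun t ht =>
    hX t₀ y ⟨fun t ht => hy t (EReal.coe_lt_coe_iff.1 ht), fun _ _ => rfl⟩ t
      (EReal.coe_lt_coe_iff.2 ht)
  refine ⟨⟨X, sSup S, (EReal.bot_lt_coe t₀).trans_le (le_sSup hS), hXd, fun t ht => ?_,
    fun T z hT hz hag => ?_⟩, hXy⟩
  · simp [X, not_lt.2 ht]
  · refine absurd (le_sSup (s := S) ⟨z, hz, fun t ht => ?_⟩) (not_le.2 hT)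
    rw [hag t ((EReal.coe_lt_coe_iff.2 ht).trans_le (le_sSup hS)), hXy t ht]

theorem GradientFlowPath.eventually_hasDerivAt {f : E → ℝ} (x : GradientFlowPath f) :
    ∃ t₀ : ℝ, ∀ t ≤ t₀, HasDerivAt x (-∇ f (x t)) t := by
  obtain ⟨t₀, -, ht₀⟩ := EReal.lt_iff_exists_real_btwn.1 x.bot_lt_endTime
  exact ⟨t₀, fun t ht => x.hasDerivAt t ((EReal.coe_le_coe_iff.2 ht).trans_lt ht₀)⟩

end Paths

/-! ### Escape profiles and asymptotically equivalent solutions -/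

/-- A positive solution of `p' = s p ^ (j + 1)` near `-∞` which vanishes at `-∞`. -/
structure IsEscapeProfile (j : ℕ) (s : ℝ) (p : ℝ → ℝ) : Prop where
  eventually_pos : ∀ᶠ t in atBot, 0 < p t
  eventually_hasDerivAt : ∀ᶠ t in atBot, HasDerivAt p (s * p t ^ (j + 1)) t
  tendsto_zero : Tendsto p atBot (𝓝 0)

namespace IsEscapeProfile

variable {j : ℕ} {s : ℝ} {p : ℝ → ℝ}

theorem comp_add (hp : IsEscapeProfile j s p) (a : ℝ) :
    IsEscapeProfile j s fun t => p (t + a) := by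
  have h : Tendsto (fun t : ℝ => t + a) atBot atBot := tendsto_atBot_add_const_right _ _ tendsto_id
  refine ⟨h.eventually hp.eventually_pos, ?_, hp.tendsto_zero.comp h⟩
  filter_upwards [h.eventually hp.eventually_hasDerivAt] with t ht
  exact ht.comp_add_const t a

theorem exists_monotoneOn (hp : IsEscapeProfile j s p) (hs : 0 < s) :
    ∃ a, MonotoneOn p (Set.Iic a) ∧ ∀ t ≤ a, 0 < p t ∧ HasDerivAt p (s * p t ^ (j + 1)) t := by
  obtain ⟨a, ha⟩ := eventually_atBot.1 (hp.eventually_pos.and hp.eventually_hasDerivAt)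
  refine ⟨a, ?_, ha⟩
  refine monotoneOn_of_hasDerivWithinAt_nonneg (f' := fun t => s * p t ^ (j + 1)) (convex_Iic a)
    (fun t ht => (ha t ht).2.continuousAt.continuousWithinAt) ?_ ?_
  · intro t ht
    exact (ha t (interior_subset (s := Set.Iic a) ht)).2.hasDerivWithinAt
  · intro t ht
    have := (ha t (interior_subset (s := Set.Iic a) ht)).1
    positivity

/-- A time shift absorbs perturbations of order `p ^ M`. -/
theorem eventually_add_le (hp : IsEscapeProfile j s p) (hs : 0 < s) {M : ℕ} (hM : j + 1 ≤ M)
    {R : ℝ} (hR : 0 ≤ R) : ∀ᶠ t in atBot, p t + R * p t ^ M ≤ p (t + R / s) := by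
  obtain ⟨a, hmono, ha⟩ := hp.exists_monotoneOn hs
  filter_upwards [eventually_le_atBot (a - R / s),
    hp.tendsto_zero.eventually_le_const (zero_lt_one' ℝ)] with t ht hp1
  have hRs : 0 ≤ R / s := by positivity
  have hp0 := (ha t (by linarith)).1
  -- As `p` increases, its slope on the interval is at least `s * p t ^ (j + 1)`; over a length `R /
  -- s` this gains `R * p t ^ (j + 1)`, which dominates `R * p t ^ M` once `p t ≤ 1`.
  have h1 := (convex_Icc t (t + R / s)).mul_sub_le_image_sub_of_le_deriv (f := p)
    (C := s * p t ^ (j + 1))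
    (fun r hr => (ha r (by linarith [hr.2])).2.continuousAt.continuousWithinAt)
    (fun r hr => (ha r (by
      have := (interior_subset hr).2
      linarith)).2.differentiableAt.differentiableWithinAt)
    (fun r hr => by
      have hr' := interior_subset hr
      have hra : r ≤ a := by linarith [hr'.2]
      rw [(ha r hra).2.deriv]
      have := hmono (show t ∈ Set.Iic a by simp; linarith) hra hr'.1
      gcongr)
    t ⟨le_rfl, by linarith⟩ (t + R / s) ⟨by linarith, le_rfl⟩ (by linarith)
  have h2 : p t ^ M ≤ p t ^ (j + 1) := pow_le_pow_of_le_one hp0.le hp1 hM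
  have h3 : s * p t ^ (j + 1) * (t + R / s - t) = R * p t ^ (j + 1) := by
    field_simp
    ring
  rw [h3] at h1
  have := mul_le_mul_of_nonneg_left h2 hR
  linarith

theorem hasDerivAt_pow {t : ℝ} (h : HasDerivAt p (s * p t ^ (j + 1)) t) {M : ℕ} (hM : 1 ≤ M) :
    HasDerivAt (fun t => p t ^ M) (M * s * p t ^ (j + M)) t := by
  convert! h.pow M using 1
  obtain ⟨n, rfl⟩ := Nat.exists_eq_add_of_le hM
  simp only [Nat.add_sub_cancel_left]
  ring

end IsEscapeProfile

/-- Provides the globally continuous data needed for Picard iteration when control exists only near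
`-∞`. -/
theorem continuous_comp_min {F : Type*} [TopologicalSpace F] {g : ℝ → F} {t₀ : ℝ}
    (hg : ∀ t ≤ t₀, ContinuousAt g t) : Continuous fun t => g (min t t₀) := by
  refine continuous_iff_continuousAt.2 fun t => ?_
  exact ContinuousAt.comp (f := fun t : ℝ => min t t₀) (hg _ (min_le_right _ _))
    (continuous_id.min continuous_const).continuousAt

section Comparison

variable {E : Type*} [NormedAddCommGroup E] [NormedSpace ℝ E] {j M : ℕ} {s c δ : ℝ} {p : ℝ → ℝ}
  {v : E → E}

/-- Picard iteration for `z = y - x` with weight `p ^ M`. Only the values of `u` along `x` enter, so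
no Lipschitz bound on `u` is needed. -/
theorem exists_asymptotic_solution [CompleteSpace E] (hp : IsEscapeProfile j s p) (hs : 0 < s)
    (hM : 2 ≤ M) {u : E → E} {K : ℝ} (hu : Continuous u) (hv : Continuous v) (hδ : 0 < δ)
    (hc0 : 0 ≤ c) (hc : c < M * s) (hK : 0 ≤ K)
    (hLip : ∀ x y, ‖x‖ ≤ δ → ‖y‖ ≤ δ → ‖v x - v y‖ ≤ c * max ‖x‖ ‖y‖ ^ j * ‖x - y‖)
    (hvu : ∀ x, ‖x‖ ≤ δ → ‖v x - u x‖ ≤ K * ‖x‖ ^ (j + M)) {x : ℝ → E}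
    (hx : ∀ᶠ t in atBot, HasDerivAt x (u (x t)) t) (hxp : ∀ᶠ t in atBot, ‖x t‖ ≤ p t) :
    ∃ R, 0 ≤ R ∧ ∃ (y : ℝ → E) (t₀ : ℝ), (∀ t < t₀, HasDerivAt y (v (y t)) t) ∧
      ∀ t < t₀, ‖x t - y t‖ ≤ R * p t ^ M := by
  have hMs : 0 < M * s := lt_of_le_of_lt hc0 hc
  obtain ⟨l, hl1, hl2⟩ := exists_between ((div_lt_one hMs).2 hc)
  have hl0 : 0 ≤ l := (div_nonneg hc0 hMs.le).trans hl1.le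
  have hcl : c < l * (M * s) := (div_lt_iff₀ hMs).1 hl1
  -- Room for the correction: `x + z` lies in the ball of radius `(1 + ε) * p`, and the factor `(1 +
  -- ε) ^ j` must not spoil the contraction.
  obtain ⟨ε, hε, hε1⟩ : ∃ ε : ℝ, 0 < ε ∧ c * (1 + ε) ^ j < l * (M * s) := by
    have h1 : Tendsto (fun ε : ℝ => c * (1 + ε) ^ j) (𝓝[>] 0) (𝓝 (c * (1 + 0) ^ j)) := by
      refine Tendsto.mono_left ?_ nhdsWithin_le_nhds
      exact Continuous.tendsto (by fun_prop) 0
    have h2 := h1.eventually_lt_const (show c * (1 + 0) ^ j < l * (M * s) by simpa using hcl)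
    obtain ⟨ε, h⟩ := (h2.and self_mem_nhdsWithin).exists
    exact ⟨ε, h.2, h.1⟩
  -- Chosen so that `(1 - l) * R * (M * s) = K`, the size of the inhomogeneity.
  set R := K / ((1 - l) * (M * s)) with hRdef
  have h1l : 0 < 1 - l := by linarith
  have hR : 0 ≤ R := by positivity
  have hpsmall : ∀ᶠ t in atBot, p t < min 1 (min (δ / (1 + ε)) (ε / (R + 1))) :=
    hp.tendsto_zero.eventually_lt_const (by positivity)
  obtain ⟨t₀, ht₀⟩ := eventually_atBot.1
    ((hp.eventually_pos.and hp.eventually_hasDerivAt).and ((hx.and hxp).and hpsmall))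
  have hpos : ∀ t ≤ t₀, 0 < p t := fun t ht => (ht₀ t ht).1.1
  have hpd : ∀ t ≤ t₀, HasDerivAt p (s * p t ^ (j + 1)) t := fun t ht => (ht₀ t ht).1.2
  have hxd : ∀ t ≤ t₀, HasDerivAt x (u (x t)) t := fun t ht => (ht₀ t ht).2.1.1
  have hxle : ∀ t ≤ t₀, ‖x t‖ ≤ p t := fun t ht => (ht₀ t ht).2.1.2
  have hpδ : ∀ t ≤ t₀, (1 + ε) * p t ≤ δ := fun t ht => by
    have := ((ht₀ t ht).2.2.trans_le ((min_le_right _ _).trans (min_le_left _ _))).le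
    rwa [le_div_iff₀' (by positivity)] at this
  have hRp : ∀ t ≤ t₀, R * p t ^ M ≤ ε * p t := fun t ht => by
    have h0 := hpos t ht
    have h1 := ((ht₀ t ht).2.2.trans_le (min_le_left _ _)).le
    have h2 := ((ht₀ t ht).2.2.trans_le ((min_le_right _ _).trans (min_le_right _ _))).le
    rw [le_div_iff₀' (by positivity)] at h2
    have h3 : p t ^ M ≤ p t ^ 2 := pow_le_pow_of_le_one h0.le h1 hM
    calc R * p t ^ M ≤ R * p t ^ 2 := by gcongr
      _ = R * p t * p t := by ring
      _ ≤ ε * p t := by gcongr; linarith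
  have hxc : Continuous fun t => x (min t t₀) :=
    continuous_comp_min fun t ht => (hxd t ht).continuousAt
  have hpc : Continuous fun t => p (min t t₀) :=
    continuous_comp_min fun t ht => (hpd t ht).continuousAt
  obtain ⟨z, hz, hzb⟩ := exists_hasDerivAt_of_contracting_atBot (t₀ := t₀) (R := R) (l := l)
    (G := fun t z => v (x (min t t₀) + z) - u (x (min t t₀)))
    (w := fun t => p (min t t₀) ^ M) (w' := fun t => M * s * p (min t t₀) ^ (j + M))
    (by
      have h1 : Continuous fun q : ℝ × E => x (min q.1 t₀) := hxc.comp continuous_fst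
      exact (hv.comp (h1.add continuous_snd)).sub (hu.comp h1))
    (hpc.pow M) ((hpc.pow _).const_mul _)
    (fun t ht => by
      simp only [min_eq_left ht.le]
      refine (IsEscapeProfile.hasDerivAt_pow (hpd t ht.le) (by lia)).congr_of_eventuallyEq ?_
      filter_upwards [eventually_lt_nhds ht] with r hr
      rw [min_eq_left hr.le])
    (fun t ht => by
      have := hpos _ (min_le_right t t₀)
      positivity)
    hR hl0 hl2
    (fun t ht => by
      simp only [min_eq_left ht, add_zero]
      have h0 := hpos t ht
      have hxδ : ‖x t‖ ≤ δ := (hxle t ht).trans (by nlinarith [hpδ t ht])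
      calc _ ≤ _ := hvu _ hxδ
        _ ≤ K * p t ^ (j + M) := by gcongr; exact hxle t ht
        _ = _ := by rw [hRdef]; field_simp)
    (fun t ht z₁ z₂ h₁ h₂ => by
      simp only [min_eq_left ht] at h₁ h₂ ⊢
      have h0 := hpos t ht
      have hb : ∀ z : E, ‖z‖ ≤ R * p t ^ M → ‖x t + z‖ ≤ (1 + ε) * p t := fun z hz =>
        calc ‖x t + z‖ ≤ ‖x t‖ + ‖z‖ := norm_add_le _ _
          _ ≤ p t + ε * p t := add_le_add (hxle t ht) (hz.trans (hRp t ht))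
          _ = _ := by ring
      have e1 := hLip _ _ ((hb z₁ h₁).trans (hpδ t ht)) ((hb z₂ h₂).trans (hpδ t ht))
      rw [add_sub_add_left_eq_sub] at e1
      rw [sub_sub_sub_cancel_right]
      have e2 : max ‖x t + z₁‖ ‖x t + z₂‖ ^ j ≤ ((1 + ε) * p t) ^ j :=
        pow_le_pow_left₀ (by positivity) (max_le (hb z₁ h₁) (hb z₂ h₂)) j
      calc _ ≤ c * ((1 + ε) * p t) ^ j * ‖z₁ - z₂‖ * p t ^ M := by
            gcongr
            exact e1.trans (by gcongr)
        _ = (c * (1 + ε) ^ j) * (p t ^ (j + M) * ‖z₁ - z₂‖) := by rw [mul_pow, pow_add]; ring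
        _ ≤ (l * (M * s)) * (p t ^ (j + M) * ‖z₁ - z₂‖) := by gcongr
        _ = _ := by ring)
  refine ⟨R, hR, fun t => x t + z t, t₀, fun t ht => ?_, fun t ht => ?_⟩
  · have h1 := (hxd t ht.le).add (hz t ht)
    simp only [min_eq_left ht.le, add_sub_cancel] at h1
    exact h1
  · have h1 := hzb t ht.le
    rw [min_eq_left ht.le] at h1
    simpa [norm_neg] using h1

/-- A bound `C * p ^ M` on the difference bounds its derivative by `c * C * p ^ (j + M)`, which is
`c / (M * s) < 1` times the derivative of `C * p ^ M`; the bound therefore improves indefinitely. -/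
theorem eventually_eq_of_asymptotic (hp : IsEscapeProfile j s p) (hM : 1 ≤ M) (hδ : 0 < δ)
    (hc0 : 0 ≤ c) (hc : c < M * s)
    (hLip : ∀ x y, ‖x‖ ≤ δ → ‖y‖ ≤ δ → ‖v x - v y‖ ≤ c * max ‖x‖ ‖y‖ ^ j * ‖x - y‖)
    {y₁ y₂ : ℝ → E} (h₁ : ∀ᶠ t in atBot, HasDerivAt y₁ (v (y₁ t)) t)
    (h₂ : ∀ᶠ t in atBot, HasDerivAt y₂ (v (y₂ t)) t) (hp₁ : ∀ᶠ t in atBot, ‖y₁ t‖ ≤ p t)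
    (hp₂ : ∀ᶠ t in atBot, ‖y₂ t‖ ≤ p t) {D : ℝ} (hD : 0 ≤ D)
    (h : ∀ᶠ t in atBot, ‖y₁ t - y₂ t‖ ≤ D * p t ^ M) : ∀ᶠ t in atBot, y₁ t = y₂ t := by
  have hMs : 0 < M * s := lt_of_le_of_lt hc0 hc
  obtain ⟨t₀, ht₀⟩ := eventually_atBot.1
    ((hp.eventually_pos.and hp.eventually_hasDerivAt).and (((h₁.and h₂).and (hp₁.and hp₂)).and
      (h.and (hp.tendsto_zero.eventually_le_const hδ))))
  have := eq_zero_of_norm_deriv_le_atBot (t₀ := t₀) (d := fun t => y₁ t - y₂ t)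
    (d' := fun t => v (y₁ t) - v (y₂ t)) (w := fun t => p t ^ M)
    (w' := fun t => M * s * p t ^ (j + M)) (l := c / (M * s)) (D := D)
    (fun t ht => (ht₀ t ht).2.1.1.1.sub (ht₀ t ht).2.1.1.2)
    (fun t ht => IsEscapeProfile.hasDerivAt_pow (ht₀ t ht).1.2 hM)
    (by simpa [show M ≠ 0 by lia] using hp.tendsto_zero.pow M)
    (by positivity) ((div_lt_one hMs).2 hc) hD (fun t ht => (ht₀ t ht).2.2.1)
    (fun C hC _ hd t ht => by
      have h0 := (ht₀ t ht).1.1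
      obtain ⟨hy₁, hy₂⟩ := (ht₀ t ht).2.1.2
      have hδ' := (ht₀ t ht).2.2.2
      have := hd t ht
      calc _ ≤ _ := hLip _ _ (hy₁.trans hδ') (hy₂.trans hδ')
        _ ≤ c * p t ^ j * (C * p t ^ M) := by
          gcongr
          exact max_le hy₁ hy₂
        _ = _ := by
          have hs : s ≠ 0 := right_ne_zero_of_mul hMs.ne'
          rw [pow_add]
          field_simp)
  exact eventually_atBot.2 ⟨t₀, fun t ht => sub_eq_zero.1 (this t ht)⟩

/-- A field of size `c * r ^ (j + 1)` with `c < s` is too weak to sustain the speed `s`: each bound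
by a multiple of `p` improves by the factor `c / s`. -/
theorem eventually_eq_zero_of_slow (hp : IsEscapeProfile j s p) (hδ : 0 < δ)
    (hc0 : 0 ≤ c) (hc : c < s) (hv : ∀ x, ‖x‖ ≤ δ → ‖v x‖ ≤ c * ‖x‖ ^ (j + 1))
    {y : ℝ → E} (h : ∀ᶠ t in atBot, HasDerivAt y (v (y t)) t)
    (hyp : ∀ᶠ t in atBot, ‖y t‖ ≤ p t) : ∀ᶠ t in atBot, y t = 0 := by
  have hs : 0 < s := lt_of_le_of_lt hc0 hc
  obtain ⟨t₀, ht₀⟩ := eventually_atBot.1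
    ((hp.eventually_pos.and hp.eventually_hasDerivAt).and ((h.and hyp).and
      (hp.tendsto_zero.eventually_le_const hδ)))
  have := eq_zero_of_norm_deriv_le_atBot (t₀ := t₀) (d := y)
    (d' := fun t => v (y t)) (w := p) (w' := fun t => s * p t ^ (j + 1)) (l := c / s) (D := 1)
    (fun t ht => (ht₀ t ht).2.1.1) (fun t ht => (ht₀ t ht).1.2) hp.tendsto_zero
    (by positivity) ((div_lt_one hs).2 hc) zero_le_one
    (fun t ht => by simpa using (ht₀ t ht).2.1.2)
    -- Starting from `D = 1` only `C ≤ 1` occurs, hence `C ^ (j + 1) ≤ C`, which makes the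
    -- improvement linear in `C`.
    (fun C hC hC1 hd t ht => by
      have h0 := (ht₀ t ht).1.1
      have hCj : C ^ (j + 1) ≤ C := by
        simpa using pow_le_pow_of_le_one hC hC1 (show 1 ≤ j + 1 by lia)
      have := hd t ht
      calc _ ≤ _ := hv _ ((ht₀ t ht).2.1.2.trans (ht₀ t ht).2.2)
        _ ≤ c * (C * p t) ^ (j + 1) := by gcongr
        _ = c * (C ^ (j + 1) * p t ^ (j + 1)) := by rw [mul_pow]
        _ ≤ c * (C * p t ^ (j + 1)) := by gcongr
        _ = _ := by field_simp)
  exact eventually_atBot.2 ⟨t₀, this⟩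

end Comparison

/-! ### The model profile and the correspondence between fast escaping paths -/

/-- The model escape profile: `e ^ {s t}` if `j = 0`, else `(- s j t) ^ {-1 / j}`. -/
noncomputable def escapeProfile (j : ℕ) (s t : ℝ) : ℝ :=
  if j = 0 then Real.exp (s * t) else (s * j * -t) ^ (-(1 / (j : ℝ)))

theorem isEscapeProfile_escapeProfile (j : ℕ) {s : ℝ} (hs : 0 < s) :
    IsEscapeProfile j s (escapeProfile j s) := by
  rcases Nat.eq_zero_or_pos j with rfl | hj
  · have h : escapeProfile 0 s = fun t => Real.exp (s * t) := by
      ext t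
      simp [escapeProfile]
    rw [h]
    refine ⟨.of_forall fun t => Real.exp_pos _, .of_forall fun t => ?_, ?_⟩
    · simpa [mul_comm] using ((hasDerivAt_id t).const_mul s).exp
    · exact Real.tendsto_exp_atBot.comp (tendsto_id.const_mul_atBot hs)
  · have hj' : (0 : ℝ) < j := by exact_mod_cast hj
    have h : escapeProfile j s = fun t => (s * j * -t) ^ (-(1 / (j : ℝ))) := by
      ext t
      simp [escapeProfile, hj.ne']
    have hlin : Tendsto (fun t : ℝ => s * j * -t) atBot atTop :=
      tendsto_neg_atBot_atTop.const_mul_atTop (by positivity)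
    rw [h]
    refine ⟨?_, ?_, (tendsto_rpow_neg_atTop (by positivity)).comp hlin⟩
    · filter_upwards [eventually_lt_atBot 0] with t ht
      have : 0 < -t := by linarith
      positivity
    · filter_upwards [eventually_lt_atBot 0] with t ht
      have hb : 0 < s * j * -t := by
        have : 0 < -t := by linarith
        positivity
      have h1 : HasDerivAt (fun t : ℝ => s * j * -t) (s * j * -1) t :=
        (hasDerivAt_neg t).const_mul _
      convert! h1.rpow_const (p := -(1 / (j : ℝ))) (Or.inl hb.ne') using 1
      rw [← Real.rpow_natCast, ← Real.rpow_mul hb.le]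
      have : -(1 / (j : ℝ)) * ((j + 1 : ℕ) : ℝ) = -(1 / (j : ℝ)) - 1 := by
        push_cast
        field_simp
        ring
      rw [this]
      field_simp

theorem escapeProfile_comp_add_isBigO (j : ℕ) {s : ℝ} (hs : 0 < s) (a : ℝ) :
    (fun t => escapeProfile j s (t + a)) =O[atBot] escapeProfile j s := by
  rcases Nat.eq_zero_or_pos j with rfl | hj
  · refine IsBigO.of_bound (Real.exp (s * a)) (.of_forall fun t => ?_)
    simp [escapeProfile, mul_add, Real.exp_add, mul_comm]
  · have hj' : (0 : ℝ) < j := by exact_mod_cast hj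
    refine IsBigO.of_bound ((1 / 2 : ℝ) ^ (-(1 / (j : ℝ)))) ?_
    filter_upwards [eventually_lt_atBot (-2 * |a|), eventually_lt_atBot 0] with t ht ht0
    have h0 : 0 < -t := by linarith
    have ha := neg_abs_le a
    have ha' := le_abs_self a
    have h1 : 0 < -(t + a) := by linarith [abs_nonneg a]
    simp only [escapeProfile, hj.ne', if_false]
    rw [Real.norm_of_nonneg (by positivity), Real.norm_of_nonneg (by positivity),
      ← Real.mul_rpow (by norm_num) (by positivity)]
    refine Real.rpow_le_rpow_of_nonpos (by positivity) ?_ (by simp)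
    have : s * j * (1 / 2 * -t) ≤ s * j * -(t + a) := by
      gcongr
      linarith
    linarith

section Paths

variable {E : Type*} [NormedAddCommGroup E] [InnerProductSpace ℝ E] [CompleteSpace E]

/-- Both cases become one: for `k = 2` the constant `c` of the `O` is the time shift `log c / s`,
and otherwise the shift is `-T`. -/
theorem mem_fastEscapePaths_iff {f : E → ℝ} {j : ℕ} {s : ℝ} (hs : 0 < s)
    {x : GradientFlowPath f} : x ∈ fastEscapePaths f (j + 2) s ↔
      ∃ a, ∀ᶠ t in atBot, ‖x t‖ ≤ escapeProfile j s (t + a) := by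
  rcases Nat.eq_zero_or_pos j with rfl | hj
  · simp only [fastEscapePaths, zero_add, if_true, Set.mem_ofPred_eq, escapeProfile]
    constructor
    · intro h
      obtain ⟨c, hc0, hc⟩ := h.exists_pos
      refine ⟨Real.log c / s, hc.bound.mono fun t ht => ht.trans_eq ?_⟩
      rw [mul_add, mul_div_cancel₀ _ hs.ne', Real.exp_add, Real.exp_log hc0, mul_comm,
        Real.norm_of_nonneg (Real.exp_pos _).le]
    · rintro ⟨a, ha⟩
      refine IsBigO.of_bound (Real.exp (s * a)) (ha.mono fun t ht => ht.trans_eq ?_)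
      rw [mul_add, Real.exp_add, mul_comm, Real.norm_of_nonneg (Real.exp_pos _).le]
  · have h2 : ((j + 2 : ℕ) : ℝ) - 2 = j := by push_cast; ring
    have h3 : j + 2 ≠ 2 := by lia
    simp only [fastEscapePaths, h3, if_false, Set.mem_ofPred_eq, escapeProfile, h2, hj.ne']
    constructor
    · rintro ⟨T, hT⟩
      refine ⟨-T, hT.mono fun t ht => ht.trans_eq ?_⟩
      congr 2
      ring
    · rintro ⟨a, ha⟩
      refine ⟨-a, ha.mono fun t ht => ht.trans_eq ?_⟩
      congr 2
      ring

/-- The gradients of the two costs have the same leading part of degree `j + 1`, agree up to order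
`j + M`, and have a leading part whose Lipschitz constant is small compared to the speed `s`. -/
structure AsymptoticCosts (f g : E → ℝ) (j M : ℕ) (s : ℝ) : Prop where
  speed_pos : 0 < s
  two_le : 2 ≤ M
  lipschitz_left : LipschitzOnBounded (∇ f)
  lipschitz_right : LipschitzOnBounded (∇ g)
  exists_local : ∃ δ c K : ℝ, 0 < δ ∧ 0 ≤ c ∧ c < M * s ∧ 0 ≤ K ∧
    (∀ x y, ‖x‖ ≤ δ → ‖y‖ ≤ δ → ‖∇ f x - ∇ f y‖ ≤ c * max ‖x‖ ‖y‖ ^ j * ‖x - y‖) ∧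
    (∀ x y, ‖x‖ ≤ δ → ‖y‖ ≤ δ → ‖∇ g x - ∇ g y‖ ≤ c * max ‖x‖ ‖y‖ ^ j * ‖x - y‖) ∧
    ∀ x, ‖x‖ ≤ δ → ‖∇ g x - ∇ f x‖ ≤ K * ‖x‖ ^ (j + M)
  slow : M < j + 1 → ∃ δ c : ℝ, 0 < δ ∧ 0 ≤ c ∧ c < s ∧
    (∀ x, ‖x‖ ≤ δ → ‖∇ f x‖ ≤ c * ‖x‖ ^ (j + 1)) ∧
    ∀ x, ‖x‖ ≤ δ → ‖∇ g x‖ ≤ c * ‖x‖ ^ (j + 1)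

theorem AsymptoticCosts.symm {f g : E → ℝ} {j M : ℕ} {s : ℝ} (h : AsymptoticCosts f g j M s) :
    AsymptoticCosts g f j M s := by
  obtain ⟨δ, c, K, hδ, hc0, hc, hK, hf, hg, hfg⟩ := h.exists_local
  refine ⟨h.speed_pos, h.two_le, h.lipschitz_right, h.lipschitz_left,
    ⟨δ, c, K, hδ, hc0, hc, hK, hg, hf, fun x hx => norm_sub_rev (∇ g x) _ ▸ hfg x hx⟩, fun hM => ?_⟩
  obtain ⟨δ, c, hδ, hc0, hc, hf, hg⟩ := h.slow hM
  exact ⟨δ, c, hδ, hc0, hc, hg, hf⟩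

/-- For `M ≥ j + 1` the partner stays below the profile shifted by a further `R / s`. For `M < j +
1` that shift is unavailable, but `slow` makes `x` vanish near `-∞`, and the partner is the zero
path. -/
theorem AsymptoticCosts.exists_fastEscapePath {f g : E → ℝ} {j M : ℕ} {s : ℝ}
    (h : AsymptoticCosts f g j M s) {x : GradientFlowPath f}
    (hx : x ∈ fastEscapePaths f (j + 2) s) :
    ∃ y ∈ fastEscapePaths g (j + 2) s,
      (fun t => x t - y t) =O[atBot] fun t => escapeProfile j s t ^ M := by
  have hs := h.speed_pos
  obtain ⟨a, ha⟩ := (mem_fastEscapePaths_iff hs).1 hx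
  have hp := (isEscapeProfile_escapeProfile j hs).comp_add a
  obtain ⟨t₁, ht₁⟩ := x.eventually_hasDerivAt
  rcases lt_or_ge M (j + 1) with hM | hM
  · obtain ⟨δ, c, hδ, hc0, hc, hf, hg⟩ := h.slow hM
    have h0 : ∇ g 0 = 0 := by simpa using hg 0 (by simpa using hδ.le)
    obtain ⟨y, hy⟩ := exists_gradientFlowPath h.lipschitz_right (y := fun _ => 0) (t₀ := 0)
      fun t _ => by simpa [h0] using hasDerivAt_const t (0 : E)
    have hy0 : ∀ᶠ t in atBot, y t = 0 := (eventually_lt_atBot 0).mono hy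
    have hx0 := eventually_eq_zero_of_slow (v := fun x => -∇ f x) hp hδ hc0 hc
      (by simpa using hf) (eventually_atBot.2 ⟨t₁, ht₁⟩) ha
    refine ⟨y, (mem_fastEscapePaths_iff hs).2 ⟨a, ?_⟩, ?_⟩
    · filter_upwards [hp.eventually_pos, hy0] with t ht hyt
      simpa [hyt] using ht.le
    · refine IsBigO.of_bound 1 ?_
      filter_upwards [hx0, hy0] with t hxt hyt
      rw [hxt, hyt]
      simp
  · obtain ⟨δ, c, K, hδ, hc0, hc, hK, -, hg, hfg⟩ := h.exists_local
    obtain ⟨R, hR, z, t₀, hz, hzb⟩ := exists_asymptotic_solution (v := fun x => -∇ g x)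
      (u := fun x => -∇ f x) hp hs h.two_le h.lipschitz_left.neg.continuous
      h.lipschitz_right.neg.continuous hδ hc0 hc hK
      (fun x y hx hy => by simpa [neg_add_eq_sub, norm_sub_rev] using hg x y hx hy)
      (fun x hx => by simpa [neg_add_eq_sub, norm_sub_rev] using hfg x hx)
      (eventually_atBot.2 ⟨t₁, ht₁⟩) ha
    obtain ⟨y, hy⟩ := exists_gradientFlowPath h.lipschitz_right hz
    refine ⟨y, (mem_fastEscapePaths_iff hs).2 ⟨a + R / s, ?_⟩, ?_⟩
    · filter_upwards [hp.eventually_add_le hs hM hR, eventually_lt_atBot t₀, ha] with t h1 h2 h3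
      have h4 := hzb t h2
      rw [hy t h2]
      calc ‖z t‖ = ‖x t - (x t - z t)‖ := by rw [sub_sub_cancel]
        _ ≤ ‖x t‖ + ‖x t - z t‖ := norm_sub_le _ _
        _ ≤ _ := (add_le_add h3 h4).trans h1
        _ = _ := by rw [add_right_comm, add_assoc]
    · have h1 : (fun t => x t - y t) =O[atBot] fun t => escapeProfile j s (t + a) ^ M := by
        refine IsBigO.of_bound R ?_
        filter_upwards [eventually_lt_atBot t₀, hp.eventually_pos] with t h2 h3
        rw [hy t h2, Real.norm_of_nonneg (by positivity)]
        exact hzb t h2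
      exact h1.trans ((escapeProfile_comp_add_isBigO j hs a).pow M)

theorem AsymptoticCosts.fastEscapePath_unique {f g : E → ℝ} {j M : ℕ} {s : ℝ}
    (h : AsymptoticCosts f g j M s) {y₁ y₂ : GradientFlowPath g}
    (h₁ : y₁ ∈ fastEscapePaths g (j + 2) s) (h₂ : y₂ ∈ fastEscapePaths g (j + 2) s)
    (hy : (fun t => y₁ t - y₂ t) =O[atBot] fun t => escapeProfile j s t ^ M) : y₁ = y₂ := by
  have hs := h.speed_pos
  obtain ⟨a₁, ha₁⟩ := (mem_fastEscapePaths_iff hs).1 h₁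
  obtain ⟨a₂, ha₂⟩ := (mem_fastEscapePaths_iff hs).1 h₂
  have hp := isEscapeProfile_escapeProfile j hs
  obtain ⟨b, hmono, -⟩ := hp.exists_monotoneOn hs
  -- The profile increases near `-∞`, so the larger shift bounds both paths at once.
  set a := max a₁ a₂
  have hle : ∀ᶠ t in atBot, ∀ a' ≤ a, escapeProfile j s (t + a') ≤ escapeProfile j s (t + a) := by
    filter_upwards [eventually_le_atBot (b - a)] with t ht a' ha'
    exact hmono (by simp only [Set.mem_Iic]; linarith) (by simp only [Set.mem_Iic]; linarith)
      (by linarith)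
  have hshift : (fun t => escapeProfile j s t) =O[atBot] fun t => escapeProfile j s (t + a) := by
    have := (escapeProfile_comp_add_isBigO j hs (-a)).comp_tendsto
      (tendsto_atBot_add_const_right atBot a tendsto_id)
    simpa [Function.comp_def] using this
  obtain ⟨D, hD, hDb⟩ := (hy.trans (hshift.pow M)).exists_nonneg
  obtain ⟨δ, c, K, hδ, hc0, hc, hK, -, hg, -⟩ := h.exists_local
  refine GradientFlowPath.eq_of_eventuallyEq h.lipschitz_right ?_
  refine eventually_eq_of_asymptotic (v := fun x => -∇ g x) (hp.comp_add a)
    (one_le_two.trans h.two_le) hδ hc0 hc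
    (fun x y hx hy => by simpa [neg_add_eq_sub, norm_sub_rev] using hg x y hx hy)
    (eventually_atBot.2 y₁.eventually_hasDerivAt) (eventually_atBot.2 y₂.eventually_hasDerivAt)
    ?_ ?_ hD ?_
  · filter_upwards [ha₁, hle] with t h1 h2 using h1.trans (h2 _ (le_max_left _ _))
  · filter_upwards [ha₂, hle] with t h1 h2 using h1.trans (h2 _ (le_max_right _ _))
  · filter_upwards [hDb.bound, (hp.comp_add a).eventually_pos] with t h1 h2
    rwa [Real.norm_of_nonneg (by positivity)] at h1

/-- Uniqueness of partners on the right already determines the map; uniqueness and existence on the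
left make it bijective. -/
theorem existsUnique_bijective_of_rel {α β : Type*} {r : α → β → Prop} (h₁ : ∀ x, ∃! y, r x y)
    (h₂ : ∀ y, ∃! x, r x y) : ∃! F : α → β, Function.Bijective F ∧ ∀ x, r x (F x) := by
  choose F hF hu using h₁
  refine ⟨F, ⟨⟨fun x₁ x₂ hx => ?_, fun y => ?_⟩, hF⟩, fun F' hF' => ?_⟩
  · exact (h₂ (F x₁)).unique (hF x₁) (hx ▸ hF x₂)
  · obtain ⟨x, hx, -⟩ := h₂ y
    exact ⟨x, (hu x y hx).symm⟩
  · ext x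
    exact hu x _ (hF'.2 x)

theorem AsymptoticCosts.existsUnique_bijective {f g : E → ℝ} {j M : ℕ} {s : ℝ}
    (h : AsymptoticCosts f g j M s) {W : ℝ → ℝ}
    (hW : W =Θ[atBot] fun t => escapeProfile j s t ^ M) :
    ∃! F : ↥(fastEscapePaths f (j + 2) s) → ↥(fastEscapePaths g (j + 2) s),
      Function.Bijective F ∧ ∀ x, (fun t : ℝ => x.1 t - (F x).1 t) =O[atBot] W := by
  refine existsUnique_bijective_of_rel (α := ↥(fastEscapePaths f (j + 2) s))
    (β := ↥(fastEscapePaths g (j + 2) s)) (r := fun x y => (fun t : ℝ => x.1 t - y.1 t) =O[atBot] W)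
    (fun x => ?_) fun y => ?_
  · obtain ⟨y, hy, hxy⟩ := h.exists_fastEscapePath x.2
    refine ⟨⟨y, hy⟩, hxy.trans hW.2, fun y' hy' => Subtype.ext ?_⟩
    refine h.fastEscapePath_unique y'.2 hy ?_
    simpa using hxy.sub (hy'.trans hW.1)
  · obtain ⟨x, hx, hxy⟩ := h.symm.exists_fastEscapePath y.2
    have hyx : ∀ x : GradientFlowPath f, ((fun t => y.1 t - x t) =O[atBot] fun t =>
        escapeProfile j s t ^ M) ↔ (fun t => x t - y.1 t) =O[atBot] W := fun x =>
      ⟨fun h => (h.neg_left.congr_left fun t => neg_sub _ _).trans hW.2,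
        fun h => (h.neg_left.congr_left fun t => neg_sub _ _).trans hW.1⟩
    refine ⟨⟨x, hx⟩, (hyx x).1 hxy, fun x' hx' => Subtype.ext ?_⟩
    refine h.symm.fastEscapePath_unique x'.2 hx ?_
    simpa using hxy.sub ((hyx _).2 hx')

end Paths

theorem exp_isTheta_escapeProfile_pow {s : ℝ} (M : ℕ) :
    (fun t => Real.exp (M * s * t)) =Θ[atBot] fun t => escapeProfile 0 s t ^ M := by
  refine IsTheta.of_norm_eventuallyEq (.of_forall fun t => ?_)
  simp [escapeProfile, ← Real.exp_nat_mul, mul_assoc]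

theorem rpow_isTheta_escapeProfile_pow {j : ℕ} (hj : j ≠ 0) {s : ℝ} (hs : 0 < s) (M : ℕ) :
    (fun t : ℝ => (-t) ^ (-((M : ℝ) / j))) =Θ[atBot] fun t => escapeProfile j s t ^ M := by
  have hj' : (0 : ℝ) < j := by exact_mod_cast hj.bot_lt
  have h : (fun t => escapeProfile j s t ^ M) =ᶠ[atBot]
      fun t => (s * j) ^ (-((M : ℝ) / j)) * (-t) ^ (-((M : ℝ) / j)) := by
    filter_upwards [eventually_lt_atBot 0] with t ht
    have ht' : 0 < -t := by linarith
    simp only [escapeProfile, hj, if_false]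
    rw [← Real.mul_rpow (by positivity) (by positivity), ← Real.rpow_natCast,
      ← Real.rpow_mul (by positivity)]
    congr 1
    ring
  refine (h.trans_isTheta ?_).symm
  exact (isTheta_const_mul_left (by positivity)).2 isTheta_rfl

/-! ### Symmetric multilinear forms and homogeneous polynomials -/

section Multilinear

/-- **Banach's theorem**: the norm of a symmetric multilinear form on a Euclidean space is attained
on the diagonal. -/
theorem ContinuousMultilinearMap.norm_le_of_symmetric {E : Type*} [NormedAddCommGroup E]
    [InnerProductSpace ℝ E] [FiniteDimensional ℝ E] {n : ℕ} (T : E [×n]→L[ℝ] ℝ)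
    (hT : ∀ (σ : Equiv.Perm (Fin n)) (v : Fin n → E), T (fun i => v (σ i)) = T v) (hn : n ≠ 0)
    {B : ℝ} (hB : 0 ≤ B) (h : ∀ x : E, ‖x‖ = 1 → |T fun _ => x| ≤ B) : ‖T‖ ≤ B := by
  have i₀ : Fin n := ⟨0, hn.bot_lt⟩
  rcases subsingleton_or_nontrivial E with hE | hE
  · refine T.opNorm_le_bound hB fun m => ?_
    rw [T.map_coord_zero i₀ (Subsingleton.elim _ _)]
    simp only [norm_zero]
    positivity
  let K₀ : Set (Fin n → E) := Set.pi Set.univ fun _ => Metric.sphere (0 : E) 1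
  have hK₀ : IsCompact K₀ := isCompact_univ_pi fun _ => isCompact_sphere _ _
  have hmem : ∀ v : Fin n → E, v ∈ K₀ ↔ ∀ i, ‖v i‖ = 1 := fun v => by simp [K₀]
  have hcT : Continuous fun v => |T v| := T.cont.abs
  obtain ⟨w, hw, hwmax⟩ := hK₀.exists_isMaxOn (by
    obtain ⟨x, hx⟩ := NormedSpace.sphere_nonempty (E := E) (x := 0) (r := 1) |>.2 zero_le_one
    exact ⟨fun _ => x, fun _ _ => hx⟩) hcT.continuousOn
  set M := |T w|
  have hM0 : 0 ≤ M := abs_nonneg _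
  have hMmax : ∀ v : Fin n → E, (∀ i, ‖v i‖ = 1) → |T v| ≤ M := fun v hv =>
    hwmax ((hmem v).2 hv)
  have hMall : ∀ m : Fin n → E, |T m| ≤ M * ∏ i, ‖m i‖ := by
    intro m
    by_cases hm : ∃ i, m i = 0
    · obtain ⟨i, hi⟩ := hm
      rw [T.map_coord_zero i hi, abs_zero]
      positivity
    · push Not at hm
      have h1 : m = fun i => ‖m i‖ • (‖m i‖⁻¹ • m i) := by
        ext i
        rw [smul_inv_smul₀ (norm_ne_zero_iff.2 (hm i))]
      have h2 := hMmax (fun i => ‖m i‖⁻¹ • m i) fun i => by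
        rw [norm_smul, norm_inv, norm_norm, inv_mul_cancel₀ (norm_ne_zero_iff.2 (hm i))]
      conv_lhs => rw [h1]
      rw [T.map_smul_univ, smul_eq_mul, abs_mul, abs_of_nonneg (by positivity), mul_comm]
      gcongr
  -- Among the maximizers of `|T|` on the product of spheres, one with the longest sum `∑ i, v i`
  -- turns out to be diagonal.
  let K : Set (Fin n → E) := K₀ ∩ {v | |T v| = M}
  have hK : IsCompact K := hK₀.inter_right (isClosed_eq hcT continuous_const)
  obtain ⟨v, ⟨hv₀, hvM⟩, hvmax⟩ := hK.exists_isMaxOn (f := fun v => ‖∑ i, v i‖) ⟨w, hw, rfl⟩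
    (by fun_prop)
  replace hv₀ := (hmem v).1 hv₀
  replace hvM : |T v| = M := hvM
  replace hvmax : ∀ v', (∀ i, ‖v' i‖ = 1) → |T v'| = M → ‖∑ i, v' i‖ ≤ ‖∑ i, v i‖ :=
    fun v' h1 h2 => hvmax ⟨(hmem v').2 h1, h2⟩
  set S := ∑ i, v i
  -- Flipping the sign of `v i` preserves `|T v|`, so it cannot lengthen the sum: `‖S - 2 v i‖ ≤
  -- ‖S‖`.
  have hpos : ∀ i, 1 ≤ inner ℝ (v i) S := by
    intro i
    have h1 := hvmax (Function.update v i ((-1 : ℝ) • v i)) (fun l => by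
      rcases eq_or_ne l i with rfl | hl
      · simp [hv₀]
      · simp [hl, hv₀]) (by
      rw [T.map_update_smul, Function.update_eq_self, neg_one_smul, abs_neg, hvM])
    have h2 : ∑ l, Function.update v i ((-1 : ℝ) • v i) l = S - (2 : ℝ) • v i := by
      rw [sub_eq_add_neg, ← sub_eq_iff_eq_add', ← Finset.sum_sub_distrib,
        Fintype.sum_eq_single i fun l hl => by simp [hl], Function.update_self]
      module
    rw [h2] at h1
    have h3 := norm_sub_sq_real S ((2 : ℝ) • v i)
    rw [inner_smul_right, norm_smul, hv₀ i, real_inner_comm] at h3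
    have h4 : ‖S - (2 : ℝ) • v i‖ ^ 2 ≤ ‖S‖ ^ 2 := by gcongr
    norm_num at h3
    linarith
  -- If `v i ≠ v j`, replace both by the unit vector along `p = v i + v j`. Polarization and the
  -- parallelogram law keep the value maximal, while the sum grows by `(2 / ‖p‖ - 1) p`. Since `‖p‖
  -- < 2` and `⟨p, S⟩ ≥ 2`, it becomes longer, a contradiction.
  have heq : ∀ i j, v i = v j := by
    intro i j
    by_contra hne
    have hij : i ≠ j := fun h => hne (h ▸ rfl)
    let b : E → E → ℝ := fun a c => T (Function.update (Function.update v i a) j c)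
    have hb_symm : ∀ a c, b a c = b c a := by
      intro a c
      simp only [b]
      rw [← hT (Equiv.swap i j)]
      congr 1
      ext l
      rcases eq_or_ne l i with rfl | hli
      · simp [hij]
      rcases eq_or_ne l j with rfl | hlj
      · simp [hij]
      · simp [Equiv.swap_apply_of_ne_of_ne hli hlj, hli, hlj]
    have hb_add : ∀ a c c', b a (c + c') = b a c + b a c' := fun a c c' =>
      T.map_update_add _ _ _ _
    have hb_smul : ∀ (r : ℝ) a c, b a (r • c) = r * b a c := fun r a c =>
      T.map_update_smul _ _ _ _
    have hb_add' : ∀ a a' c, b (a + a') c = b a c + b a' c := fun a a' c => by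
      rw [hb_symm, hb_add, hb_symm c, hb_symm c]
    have hb_smul' : ∀ (r : ℝ) a c, b (r • a) c = r * b a c := fun r a c => by
      rw [hb_symm, hb_smul, hb_symm c]
    have hb_le : ∀ a c, |b a c| ≤ M * (‖a‖ * ‖c‖) := by
      intro a c
      refine (hMall _).trans_eq ?_
      rw [Fintype.prod_eq_mul i j hij fun l hl => by simp [hl.1, hl.2, hv₀]]
      simp [hij]
    have hbv : b (v i) (v j) = T v := by simp [b]
    set p := v i + v j
    set q := v i - v j
    have hpol : b p p = 4 * b (v i) (v j) + b q q := by
      have hq : q = v i + (-1 : ℝ) • v j := by simp [q, sub_eq_add_neg]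
      rw [hq]
      simp only [p, hb_add, hb_add', hb_smul, hb_smul', hb_symm (v j) (v i)]
      ring
    have hpar : ‖p‖ ^ 2 + ‖q‖ ^ 2 = 4 := by
      have := parallelogram_law_with_norm ℝ (v i) (v j)
      rw [hv₀, hv₀] at this
      simp only [p, q]
      linarith
    have hq0 : 0 < ‖q‖ := norm_pos_iff.2 (sub_ne_zero.2 hne)
    have hpS : 2 ≤ inner ℝ p S := by
      rw [inner_add_left]
      linarith [hpos i, hpos j]
    have hp0 : 0 < ‖p‖ := by
      rw [norm_pos_iff]
      rintro h0
      rw [h0, inner_zero_left] at hpS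
      linarith
    have hp2 : ‖p‖ < 2 := by nlinarith
    have hbp : M * ‖p‖ ^ 2 ≤ |b p p| := by
      have h1 := hb_le q q
      have h2 : 4 * M ≤ |b p p| + |b q q| := by
        rw [← hvM, ← hbv]
        calc 4 * |b (v i) (v j)| = |b p p - b q q| := by
              rw [hpol, add_sub_cancel_right, abs_mul]
              norm_num
          _ ≤ _ := abs_sub _ _
      have h3 : M * ‖p‖ ^ 2 = 4 * M - M * (‖q‖ * ‖q‖) := by
        rw [← sq, eq_sub_iff_add_eq, ← mul_add, hpar, mul_comm]
      linarith
    set u := ‖p‖⁻¹ • p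
    have hu : ‖u‖ = 1 := by
      simp only [u]
      rw [norm_smul, norm_inv, norm_norm, inv_mul_cancel₀ hp0.ne']
    have hbu : M ≤ |b u u| := by
      simp only [u]
      rw [hb_smul, hb_smul', abs_mul, abs_mul, abs_inv, abs_norm]
      field_simp
      exact hbp
    have hnorm : ∀ l, ‖Function.update (Function.update v i u) j u l‖ = 1 := by
      intro l
      rcases eq_or_ne l j with rfl | hlj
      · simp [hu]
      rcases eq_or_ne l i with rfl | hli
      · simp [hlj, hu]
      · simp [hli, hlj, hv₀]
    have h1 := hvmax _ hnorm (le_antisymm (hMmax _ hnorm) hbu)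
    have h2 : ∑ l, Function.update (Function.update v i u) j u l = S + (2 * ‖p‖⁻¹ - 1) • p := by
      rw [← sub_eq_iff_eq_add', ← Finset.sum_sub_distrib,
        Fintype.sum_eq_add i j hij fun l hl => by simp [hl.1, hl.2]]
      simp only [hij, u, p, ne_eq, not_false_eq_true, Function.update_of_ne, Function.update_self]
      module
    rw [h2] at h1
    have h3 := real_inner_le_norm (S + (2 * ‖p‖⁻¹ - 1) • p) S
    rw [inner_add_left, inner_smul_left, real_inner_self_eq_norm_sq] at h3
    have h4 : ‖S + (2 * ‖p‖⁻¹ - 1) • p‖ * ‖S‖ ≤ ‖S‖ ^ 2 := by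
      rw [sq]
      gcongr
    have h5 : 0 < 2 * ‖p‖⁻¹ - 1 := by
      rw [sub_pos, ← div_eq_mul_inv, one_lt_div hp0]
      exact hp2
    have h6 : 0 < (2 * ‖p‖⁻¹ - 1) * inner ℝ p S := by positivity
    simp only [RCLike.conj_to_real] at h3
    linarith
  have hMB : M ≤ B := by
    rw [← hvM]
    have : v = fun _ => v i₀ := funext fun i => heq i i₀
    rw [this]
    exact h _ (hv₀ i₀)
  refine T.opNorm_le_bound hB fun m => (hMall m).trans ?_
  gcongr

variable {E F : Type*} [NormedAddCommGroup E] [NormedSpace ℝ E] [NormedAddCommGroup F]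
  [NormedSpace ℝ F] {n : ℕ} (T : E [×n]→L[ℝ] F)

theorem ContinuousMultilinearMap.hasFDerivAt_diag (x : E) :
    HasFDerivAt (fun x => T fun _ => x)
      ((T.linearDeriv fun _ => x).comp (ContinuousLinearMap.pi fun _ => .id ℝ E)) x := by
  have h : HasFDerivAt (fun (x : E) (_ : Fin n) => x)
      (ContinuousLinearMap.pi fun _ => .id ℝ E) x :=
    (ContinuousLinearMap.pi fun _ : Fin n => ContinuousLinearMap.id ℝ E).hasFDerivAt
  exact (T.hasFDerivAt (fun _ => x)).comp x h

theorem ContinuousMultilinearMap.contDiff_diag {m : WithTop ℕ∞} :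
    ContDiff ℝ m fun x => T fun _ => x :=
  T.contDiff.comp (contDiff_pi.2 fun _ => contDiff_id)

theorem ContinuousMultilinearMap.fderiv_diag_apply (x y : E) :
    fderiv ℝ (fun x => T fun _ => x) x y = ∑ i, T (Function.update (fun _ => x) i y) := by
  rw [(T.hasFDerivAt_diag x).fderiv]
  simp

theorem ContinuousMultilinearMap.norm_fderiv_diag_le (x : E) :
    ‖fderiv ℝ (fun x => T fun _ => x) x‖ ≤ n * ‖T‖ * ‖x‖ ^ (n - 1) := by
  refine ContinuousLinearMap.opNorm_le_bound _ (by positivity) fun y => ?_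
  rw [T.fderiv_diag_apply]
  calc _ ≤ ∑ i : Fin n, ‖T‖ * ‖x‖ ^ (n - 1) * ‖y‖ := by
        refine norm_sum_le_of_le _ fun i _ => (T.le_opNorm _).trans_eq ?_
        rw [← Finset.mul_prod_erase _ _ (Finset.mem_univ i),
          Finset.prod_congr (g := fun _ => ‖x‖) rfl fun l hl => by
            simp [Finset.ne_of_mem_erase hl]]
        simp
        ring
    _ = _ := by simp; ring

/-- In the `i`-th term of the derivative, slot `i` holds the same `z` at both points, so only `n -
1` slots vary. The constant `n (n - 1) ‖T‖` is what sets the speed threshold. -/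
theorem ContinuousMultilinearMap.norm_fderiv_diag_sub_le (x y : E) :
    ‖fderiv ℝ (fun x => T fun _ => x) x - fderiv ℝ (fun x => T fun _ => x) y‖ ≤
      n * (n - 1 : ℕ) * ‖T‖ * max ‖x‖ ‖y‖ ^ (n - 2) * ‖x - y‖ := by
  refine ContinuousLinearMap.opNorm_le_bound _ (by positivity) fun z => ?_
  rw [sub_apply, T.fderiv_diag_apply, T.fderiv_diag_apply,
    ← Finset.sum_sub_distrib]
  set r := max ‖x‖ ‖y‖
  calc _ ≤ ∑ i : Fin n, (n - 1 : ℕ) * ‖T‖ * r ^ (n - 2) * ‖x - y‖ * ‖z‖ := by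
        refine norm_sum_le_of_le _ fun i _ => (T.norm_image_sub_le' _ _).trans ?_
        have hterm : ∀ l, (∏ l', if l' = l then
            ‖Function.update (fun _ => x) i z l - Function.update (fun _ => y) i z l‖
            else max ‖Function.update (fun _ => x) i z l'‖ ‖Function.update (fun _ => y) i z l'‖) =
            if l = i then 0 else r ^ (n - 2) * ‖x - y‖ * ‖z‖ := by
          intro l
          split_ifs with hl
          · subst hl
            exact Finset.prod_eq_zero (Finset.mem_univ l) (by simp)
          · rw [← Finset.mul_prod_erase _ _ (Finset.mem_univ l),
              ← Finset.mul_prod_erase _ _ (Finset.mem_erase.2 ⟨Ne.symm hl, Finset.mem_univ i⟩),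
              Finset.prod_congr (g := fun _ => r) rfl fun l' hl' => by
                simp only [Finset.mem_erase] at hl'
                simp [hl'.1, hl'.2.1, r]]
            have hcard : ((Finset.univ.erase l).erase i).card = n - 2 := by
              rw [Finset.card_erase_of_mem (Finset.mem_erase.2 ⟨Ne.symm hl, Finset.mem_univ i⟩),
                Finset.card_erase_of_mem (Finset.mem_univ l), Finset.card_univ, Fintype.card_fin]
              lia
            rw [Finset.prod_const, hcard]
            simp [hl, Ne.symm hl]
            ring
        rw [Finset.sum_congr rfl fun l _ => hterm l]
        rw [← Finset.add_sum_erase _ _ (Finset.mem_univ i),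
          Finset.sum_congr (g := fun _ => r ^ (n - 2) * ‖x - y‖ * ‖z‖) rfl fun l hl => by
            simp [Finset.ne_of_mem_erase hl]]
        simp
        apply le_of_eq
        ring
    _ = _ := by simp; ring

end Multilinear

/-! ### Homogeneous polynomials as diagonals of multilinear forms. -/

section HomogeneousPolynomial

variable {ι : Type*} {k : ℕ}

/-- List the variables with multiplicity and feed one argument to each. -/
theorem exists_multilinear_monomial (d : ι →₀ ℕ) (hd : d.degree = k) :
    ∃ T : EuclideanSpace ℝ ι [×k]→L[ℝ] ℝ, ∀ x, T (fun _ => x) = d.prod fun i e => x i ^ e := by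
  classical
  let l := d.toMultiset.toList
  have hl : l.length = k := by
    rw [Multiset.length_toList, Finsupp.card_toMultiset, ← hd]
    rfl
  subst hl
  refine ⟨(ContinuousMultilinearMap.mkPiAlgebra ℝ (Fin l.length) ℝ).compContinuousLinearMap
    fun j => EuclideanSpace.proj (l.get j), fun x => ?_⟩
  have h1 : (d.toMultiset.map fun i => x i).prod = d.prod fun i e => x i ^ e := by
    rw [Finsupp.toMultiset_map, Finsupp.prod_toMultiset]
    exact Finsupp.prod_mapDomain_index (by simp) (by simp [pow_add])
  rw [← h1, ← Multiset.coe_toList d.toMultiset, Multiset.map_coe, Multiset.prod_coe]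
  change _ = (l.map _).prod
  simp only [ContinuousMultilinearMap.compContinuousLinearMap_apply,
    ContinuousMultilinearMap.mkPiAlgebra_apply]
  exact Fin.prod_univ_fun_getElem l fun i => x i

variable [Fintype ι] {H : EuclideanSpace ℝ ι → ℝ}

/-- A homogeneous polynomial is the diagonal of a symmetric multilinear form. -/
theorem IsHomogeneousPolynomial.exists_multilinear (hH : IsHomogeneousPolynomial k H) :
    ∃ T : EuclideanSpace ℝ ι [×k]→L[ℝ] ℝ, (∀ x, H x = T fun _ => x) ∧
      ∀ (σ : Equiv.Perm (Fin k)) v, T (fun i => v (σ i)) = T v := by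
  obtain ⟨p, hp, hpH⟩ := hH
  have h1 : ∀ d : ι →₀ ℕ, ∃ T : EuclideanSpace ℝ ι [×k]→L[ℝ] ℝ, d ∈ p.support →
      ∀ x, T (fun _ => x) = d.prod fun i e => x i ^ e := by
    intro d
    by_cases hd : d ∈ p.support
    · have hk : d.degree = k :=
        (DFunLike.congr_fun Finsupp.degree_eq_weight_one d).trans
          (hp (MvPolynomial.mem_support_iff.1 hd))
      obtain ⟨T, hT⟩ := exists_multilinear_monomial d hk
      exact ⟨T, fun _ => hT⟩
    · exact ⟨0, fun h => absurd h hd⟩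
  choose T hT using h1
  let T₁ : EuclideanSpace ℝ ι [×k]→L[ℝ] ℝ := ∑ d ∈ p.support, p.coeff d • T d
  have hT₁ : ∀ x, T₁ (fun _ => x) = H x := by
    intro x
    rw [hpH, MvPolynomial.eval_eq']
    simp only [T₁, sum_apply, smul_apply,
      smul_eq_mul]
    refine Finset.sum_congr rfl fun d hd => ?_
    rw [hT d hd, Finsupp.prod_fintype _ _ (by simp)]
  refine ⟨(k.factorial : ℝ)⁻¹ • ∑ τ : Equiv.Perm (Fin k), T₁.domDomCongr τ, fun x => ?_,
    fun σ v => ?_⟩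
  · simp only [smul_apply, sum_apply,
      ContinuousMultilinearMap.domDomCongr_apply, hT₁]
    have : (k.factorial : ℝ) ≠ 0 := by exact_mod_cast k.factorial_ne_zero
    simp [Fintype.card_perm, this]
  · simp only [smul_apply, sum_apply,
      ContinuousMultilinearMap.domDomCongr_apply]
    congr 1
    exact Fintype.sum_equiv (Equiv.mulLeft σ) _ _ fun τ => rfl

/-- Banach's theorem avoids the factor `k ^ k / k!` that plain polarization would put into the
threshold. -/
theorem IsHomogeneousPolynomial.exists_multilinear_norm_le (hk : k ≠ 0)
    (hH : IsHomogeneousPolynomial k H) :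
    ∃ T : EuclideanSpace ℝ ι [×k]→L[ℝ] ℝ, (H = fun x => T fun _ => x) ∧ ‖T‖ ≤ sphereNorm H := by
  obtain ⟨T, hT, hsymm⟩ := hH.exists_multilinear
  obtain rfl : H = fun x => T fun _ => x := funext hT
  refine ⟨T, rfl, T.norm_le_of_symmetric hsymm hk (Real.iSup_nonneg fun _ => abs_nonneg _)
    fun x hx => ?_⟩
  have hb : BddAbove (Set.range fun ρ : Metric.sphere (0 : EuclideanSpace ℝ ι) 1 =>
      |T fun _ => (ρ : EuclideanSpace ℝ ι)|) := by
    refine ⟨‖T‖, ?_⟩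
    rintro _ ⟨ρ, rfl⟩
    refine (T.le_opNorm _).trans_eq ?_
    simp
  exact le_ciSup hb ⟨x, by simpa using hx⟩

end HomogeneousPolynomial

/-! ### Perturbations of homogeneous polynomials -/

section Gradient

variable {E : Type*} [NormedAddCommGroup E] [InnerProductSpace ℝ E] [CompleteSpace E]

theorem norm_gradient_eq (f : E → ℝ) (x : E) : ‖∇ f x‖ = ‖fderiv ℝ f x‖ :=
  (InnerProductSpace.toDual ℝ E).symm.norm_map _

theorem norm_gradient_sub_gradient (f g : E → ℝ) (x y : E) :
    ‖∇ f x - ∇ g y‖ = ‖fderiv ℝ f x - fderiv ℝ g y‖ := by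
  simp only [gradient, ← map_sub]
  exact (InnerProductSpace.toDual ℝ E).symm.norm_map _

theorem lipschitzOnBounded_gradient [FiniteDimensional ℝ E] {f : E → ℝ} (hf : ContDiff ℝ 2 f) :
    LipschitzOnBounded (∇ f) := by
  intro r
  have h1 : ContDiff ℝ 1 (fderiv ℝ f) := hf.fderiv_right (by norm_num)
  obtain ⟨K, hK⟩ := (isCompact_closedBall (0 : E) r).exists_bound_of_continuousOn
    (h1.continuous_fderiv (by norm_num)).continuousOn
  refine ⟨K.toNNReal, LipschitzOnWith.of_dist_le_mul fun x hx y hy => ?_⟩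
  rw [dist_eq_norm, dist_eq_norm, norm_gradient_sub_gradient]
  refine ((convex_closedBall (0 : E) r).norm_image_sub_le_of_norm_fderiv_le
    (fun z _ => h1.differentiable (by norm_num) z) hK hy hx).trans ?_
  gcongr
  exact Real.le_coe_toNNReal K

end Gradient

/-! ### Orders of vanishing of remainders. -/

section Remainder

theorem exists_norm_le_pow_of_isBigO {E F : Type*} [NormedAddCommGroup E] [NormedAddCommGroup F]
    {φ : E → F} {n : ℕ}
    (h : φ =O[𝓝 0] fun x => ‖x‖ ^ n) :
    ∃ δ K : ℝ, 0 < δ ∧ 0 ≤ K ∧ ∀ x, ‖x‖ ≤ δ → ‖φ x‖ ≤ K * ‖x‖ ^ n := by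
  obtain ⟨K, hK, hb⟩ := h.exists_nonneg
  obtain ⟨δ, hδ, hball⟩ := Metric.nhds_basis_closedBall.eventually_iff.1 hb.bound
  refine ⟨δ, K, hδ, hK, fun x hx => ?_⟩
  simpa using hball (mem_closedBall_zero_iff.2 hx)

variable {E F : Type*} [NormedAddCommGroup E] [NormedSpace ℝ E] [NormedAddCommGroup F]
  [NormedSpace ℝ F]

/-- The mean value inequality on the ball of radius `max ‖x‖ ‖y‖`, rather than `δ`, preserves the
power. -/
theorem norm_sub_le_of_norm_fderiv_le_pow {φ : E → F} (hφ : Differentiable ℝ φ) {K δ : ℝ} {n : ℕ}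
    (hK : 0 ≤ K) (h : ∀ x, ‖x‖ ≤ δ → ‖fderiv ℝ φ x‖ ≤ K * ‖x‖ ^ n) {x y : E} (hx : ‖x‖ ≤ δ)
    (hy : ‖y‖ ≤ δ) : ‖φ x - φ y‖ ≤ K * max ‖x‖ ‖y‖ ^ n * ‖x - y‖ := by
  refine (convex_closedBall (0 : E) (max ‖x‖ ‖y‖)).norm_image_sub_le_of_norm_fderiv_le
    (fun z _ => hφ z) (fun z hz => ?_) (by simp) (by simp)
  have hz' : ‖z‖ ≤ max ‖x‖ ‖y‖ := mem_closedBall_zero_iff.1 hz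
  exact (h z (hz'.trans (max_le hx hy))).trans (by gcongr)

end Remainder

/-- Induction through `fderiv`, which changes the codomain; a single universe keeps `E →L[ℝ] F` in
the range of the induction. -/
theorem isBigO_pow_of_iteratedFDeriv_eq_zero.{u} {E F : Type u} [NormedAddCommGroup E]
    [NormedSpace ℝ E] [NormedAddCommGroup F] [NormedSpace ℝ F] {φ : E → F} (n : ℕ)
    (hφ : ContDiff ℝ ∞ φ) (h : ∀ i < n, iteratedFDeriv ℝ i φ 0 = 0) :
    φ =O[𝓝 0] fun x => ‖x‖ ^ n := by
  induction n generalizing F with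
  | zero => simpa using hφ.continuous.continuousAt.tendsto.isBigO_one ℝ
  | succ n ih =>
    have h1 : fderiv ℝ φ =O[𝓝 0] fun x => ‖x‖ ^ n := by
      refine ih (hφ.fderiv_right (by norm_cast)) fun i hi => ?_
      rw [← norm_eq_zero, norm_iteratedFDeriv_fderiv, h (i + 1) (by lia), norm_zero]
    have h0 : φ 0 = 0 := by
      rw [← norm_eq_zero, ← norm_iteratedFDeriv_zero (𝕜 := ℝ), h 0 (by lia), norm_zero]
    obtain ⟨δ, K, hδ, hK, hb⟩ := exists_norm_le_pow_of_isBigO h1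
    refine IsBigO.of_bound K ?_
    filter_upwards [Metric.closedBall_mem_nhds (0 : E) hδ] with x hx
    have := norm_sub_le_of_norm_fderiv_le_pow (hφ.differentiable (by norm_num)) hK hb (x := x)
      (y := 0) (by simpa using hx) (by simpa using hδ.le)
    simpa [h0, pow_succ, mul_assoc] using this

/-- Higher-order perturbations of a homogeneous polynomial do not change its fast escaping paths
asymptotically. -/
theorem asymptoticCosts_of_homogeneous {ι : Type*} [Fintype ι] {H e g : EuclideanSpace ℝ ι → ℝ}
    {j M : ℕ} {s : ℝ} (hH : IsHomogeneousPolynomial (j + 2) H) (hg : ∀ x, g x = H x + e x)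
    (he : ContDiff ℝ 2 e) (he0 : fderiv ℝ e 0 = 0) (hM : 2 ≤ M) {δ K : ℝ} (hδ : 0 < δ)
    (hK : 0 ≤ K)
    (hLip : ∀ x y, ‖x‖ ≤ δ → ‖y‖ ≤ δ →
      ‖fderiv ℝ e x - fderiv ℝ e y‖ ≤ K * max ‖x‖ ‖y‖ ^ (j + M - 1) * ‖x - y‖)
    (hs : (j + 1) * ((j + 2) * sphereNorm H) < M * s) : AsymptoticCosts H g j M s := by
  obtain ⟨T, hHT, hTB⟩ := hH.exists_multilinear_norm_le (by lia)
  set B := sphereNorm H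
  have hB : 0 ≤ B := (norm_nonneg T).trans hTB
  have hM' : (0 : ℝ) < M := by exact_mod_cast (by lia : 0 < M)
  have hs0 : 0 < s := by
    have : 0 < M * s := lt_of_le_of_lt (by positivity) hs
    exact pos_of_mul_pos_right this hM'.le
  have hHc : ContDiff ℝ 2 H := by
    rw [hHT]
    exact T.contDiff_diag
  have hgc : ContDiff ℝ 2 g := by
    rw [funext hg]
    exact hHc.add he
  have hgd : ∀ x, fderiv ℝ g x = fderiv ℝ H x + fderiv ℝ e x := by
    intro x
    rw [funext hg]
    exact fderiv_fun_add (hHc.differentiable (by norm_num) x) (he.differentiable (by norm_num) x)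
  have hH1 : ∀ x, ‖fderiv ℝ H x‖ ≤ (j + 2) * B * ‖x‖ ^ (j + 1) := by
    intro x
    have := T.norm_fderiv_diag_le x
    rw [← hHT] at this
    refine this.trans ?_
    push_cast
    gcongr
  have hH2 : ∀ x y, ‖fderiv ℝ H x - fderiv ℝ H y‖ ≤
      (j + 1) * ((j + 2) * B) * max ‖x‖ ‖y‖ ^ j * ‖x - y‖ := by
    intro x y
    have := T.norm_fderiv_diag_sub_le x y
    rw [← hHT] at this
    simp only [Nat.add_sub_cancel, show j + 2 - 1 = j + 1 by lia] at this
    refine this.trans ?_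
    calc _ ≤ ((j + 2 : ℕ) : ℝ) * ((j + 1 : ℕ) : ℝ) * B * max ‖x‖ ‖y‖ ^ j * ‖x - y‖ := by gcongr
      _ = _ := by push_cast; ring
  have he1 : ∀ x, ‖x‖ ≤ δ → ‖fderiv ℝ e x‖ ≤ K * ‖x‖ ^ (j + M) := by
    intro x hx
    have := hLip x 0 hx (by simpa using hδ.le)
    rw [he0, sub_zero, sub_zero, norm_zero, max_eq_left (norm_nonneg x), mul_assoc,
      ← pow_succ, show j + M - 1 + 1 = j + M by lia] at this
    exact this
  -- on a small ball the remainder is dominated by any multiple of the leading part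
  have hsmall : ∀ η : ℝ, 0 < η → ∃ δ' : ℝ, 0 < δ' ∧ δ' ≤ δ ∧
      (∀ x y, ‖x‖ ≤ δ' → ‖y‖ ≤ δ' →
        ‖fderiv ℝ e x - fderiv ℝ e y‖ ≤ η * max ‖x‖ ‖y‖ ^ j * ‖x - y‖) := by
    intro η hη
    refine ⟨min δ (min 1 (η / (K + 1))), by positivity, min_le_left _ _, fun x y hx hy => ?_⟩
    refine (hLip x y (hx.trans (min_le_left _ _)) (hy.trans (min_le_left _ _))).trans ?_
    have hr := max_le hx hy
    set r := max ‖x‖ ‖y‖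
    have hr0 : 0 ≤ r := (norm_nonneg x).trans (le_max_left _ _)
    have hr1 : r ≤ 1 := hr.trans ((min_le_right _ _).trans (min_le_left _ _))
    have hr2 : r ≤ η / (K + 1) := hr.trans ((min_le_right _ _).trans (min_le_right _ _))
    rw [le_div_iff₀ (by positivity)] at hr2
    have h1 : r ^ (j + M - 1) ≤ r ^ (j + 1) := pow_le_pow_of_le_one hr0 hr1 (by lia)
    gcongr ?_ * _
    calc K * r ^ (j + M - 1) ≤ K * r ^ (j + 1) := by gcongr
      _ = (K * r) * r ^ j := by ring
      _ ≤ η * r ^ j := by gcongr; linarith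
  refine ⟨hs0, hM, lipschitzOnBounded_gradient hHc, lipschitzOnBounded_gradient hgc, ?_, ?_⟩
  · obtain ⟨c, hc1, hc2⟩ := exists_between hs
    obtain ⟨δ', hδ'0, hδ', hsm⟩ := hsmall (c - (j + 1) * ((j + 2) * B)) (by linarith)
    refine ⟨δ', c, K, hδ'0, (by positivity : (0 : ℝ) ≤ _).trans hc1.le, hc2, hK,
      fun x y _ _ => ?_, fun x y hx hy => ?_, fun x hx => ?_⟩
    · rw [norm_gradient_sub_gradient]
      refine (hH2 x y).trans ?_
      gcongr
    · rw [norm_gradient_sub_gradient, hgd, hgd, add_sub_add_comm]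
      calc _ ≤ _ := norm_add_le _ _
        _ ≤ _ := add_le_add (hH2 x y) (hsm x y hx hy)
        _ = _ := by ring
    · rw [norm_gradient_sub_gradient, hgd, add_sub_cancel_left]
      exact he1 x (hx.trans hδ')
  · intro hMj
    have hj : (0 : ℝ) < j + 1 := by positivity
    -- Since `M ≤ j + 1`, the factor `j + 1` cancels from the speed condition.
    have hlt : (j + 2) * B < s := by
      have h1 : (M : ℝ) ≤ j + 1 := by exact_mod_cast hMj.le
      have h2 : M * s ≤ (j + 1) * s := by gcongr
      exact lt_of_mul_lt_mul_left (hs.trans_le h2) hj.le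
    obtain ⟨c, hc1, hc2⟩ := exists_between hlt
    obtain ⟨δ', hδ'0, -, hsm⟩ := hsmall (c - (j + 2) * B) (by linarith)
    refine ⟨δ', c, hδ'0, (by positivity : (0 : ℝ) ≤ _).trans hc1.le, hc2,
      fun x hx => ?_, fun x hx => ?_⟩
    · rw [norm_gradient_eq]
      refine (hH1 x).trans ?_
      gcongr
    · rw [norm_gradient_eq, hgd]
      have h1 := hsm x 0 hx (by simpa using hδ'0.le)
      rw [he0, sub_zero, sub_zero, norm_zero, max_eq_left (norm_nonneg x)] at h1
      calc _ ≤ _ := norm_add_le _ _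
        _ ≤ _ := add_le_add (hH1 x) h1
        _ = _ := by ring

theorem IsApproxHomogeneous.asymptoticCosts {P j M : ℕ} {C H e : EuclideanSpace ℝ (Fin P) → ℝ}
    (h : IsApproxHomogeneous (j + 2) (j + M + 1) C H e) {s : ℝ}
    (hs : (j + 1) * ((j + 2) * sphereNorm H) < M * s) : AsymptoticCosts H C j M s := by
  have hM : 2 ≤ M := by have := h.lt; lia
  have h1 : ContDiff ℝ ∞ (fderiv ℝ e) := h.smooth.fderiv_right (by norm_cast)
  have h2 : ContDiff ℝ ∞ (fderiv ℝ (fderiv ℝ e)) := h1.fderiv_right (by norm_cast)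
  -- Taylor is applied to the second derivative: it gives the Lipschitz bound on `∇ e`, and the
  -- value `e 0`, which need not vanish, plays no role.
  have h3 := isBigO_pow_of_iteratedFDeriv_eq_zero (j + M - 1) h2 fun i hi => by
    rw [← norm_eq_zero, norm_iteratedFDeriv_fderiv, norm_iteratedFDeriv_fderiv,
      h.deriv_eq_zero (i + 1 + 1) (by lia) (by lia), norm_zero]
  obtain ⟨δ, K, hδ, hK, hb⟩ := exists_norm_le_pow_of_isBigO h3
  refine asymptoticCosts_of_homogeneous h.homogeneous h.eq_add (h.smooth.of_le (by norm_cast)) ?_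
    hM hδ hK (fun x y hx hy => norm_sub_le_of_norm_fderiv_le_pow
      (h1.differentiable (by norm_num)) hK hb hx hy) hs
  rw [← norm_eq_zero, ← norm_iteratedFDeriv_zero (𝕜 := ℝ), norm_iteratedFDeriv_fderiv,
    h.deriv_eq_zero (0 + 1) (by lia) (by lia), norm_zero]

theorem IsApproxHomogeneous.existsUnique_bijective_two {P m : ℕ}
    {C H e : EuclideanSpace ℝ (Fin P) → ℝ} (h : IsApproxHomogeneous 2 m C H e) {s : ℝ}
    (hs : 2 * sphereNorm H / ((m : ℝ) - 1) < s) :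
    ∃! F : ↥(fastEscapePaths H 2 s) → ↥(fastEscapePaths C 2 s),
      Function.Bijective F ∧ ∀ x : ↥(fastEscapePaths H 2 s),
        (fun t : ℝ => x.1 t - (F x).1 t) =O[atBot] fun t => Real.exp (((m : ℝ) - 1) * s * t) := by
  obtain ⟨M, rfl⟩ : ∃ M, m = 0 + M + 1 := ⟨m - 1, by have := h.lt; lia⟩
  have hM : (0 : ℝ) < M := by
    have := h.lt
    exact_mod_cast (by lia : 0 < M)
  have hm : ((0 + M + 1 : ℕ) : ℝ) - 1 = M := by push_cast; ring
  rw [hm] at hs ⊢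
  rw [div_lt_iff₀ hM] at hs
  have := IsApproxHomogeneous.asymptoticCosts (j := 0) h (s := s) (by
    push_cast
    linarith)
  exact this.existsUnique_bijective (exp_isTheta_escapeProfile_pow M)

theorem IsApproxHomogeneous.existsUnique_bijective_of_two_lt {P k m : ℕ}
    {C H e : EuclideanSpace ℝ (Fin P) → ℝ} (h : IsApproxHomogeneous k m C H e) (hk : 2 < k) {s : ℝ}
    (hs : ((k : ℝ) - 1) / ((m : ℝ) - k + 1) * (k * sphereNorm H) < s) :
    ∃! F : ↥(fastEscapePaths H k s) → ↥(fastEscapePaths C k s),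
      Function.Bijective F ∧ ∀ x : ↥(fastEscapePaths H k s),
        (fun t : ℝ => x.1 t - (F x).1 t) =O[atBot]
          fun t : ℝ => (-t) ^ (-(((m : ℝ) - k + 1) / ((k : ℝ) - 2))) := by
  obtain ⟨j, rfl⟩ : ∃ j, k = j + 2 := ⟨k - 2, by lia⟩
  obtain ⟨M, rfl⟩ : ∃ M, m = j + M + 1 := ⟨m - 1 - j, by have := h.lt; lia⟩
  have hM : (0 : ℝ) < M := by
    have := h.lt
    exact_mod_cast (by lia : 0 < M)
  have e1 : ((j + M + 1 : ℕ) : ℝ) - (j + 2 : ℕ) + 1 = M := by push_cast; ring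
  have e2 : ((j + 2 : ℕ) : ℝ) - 2 = j := by push_cast; ring
  have e3 : ((j + 2 : ℕ) : ℝ) - 1 = j + 1 := by push_cast; ring
  rw [e1, e3, div_mul_eq_mul_div, div_lt_iff₀ hM] at hs
  rw [e1, e2]
  push_cast at hs
  have := h.asymptoticCosts (s := s) (by linarith)
  exact this.existsUnique_bijective (rpow_isTheta_escapeProfile_pow (by lia) this.speed_pos M)

/-! ### Compositions with multilinear maps -/

section Composition

variable {E F : Type*} [NormedAddCommGroup E] [NormedSpace ℝ E] [NormedAddCommGroup F]
  [NormedSpace ℝ F] {j : ℕ} {C : F → ℝ} (T : E [×(j + 2)]→L[ℝ] F)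

theorem ContinuousMultilinearMap.hasFDerivAt_comp_diag_sub (hC : ContDiff ℝ 2 C) (x : E) :
    HasFDerivAt (fun x => C (T fun _ => x) - fderiv ℝ C 0 (T fun _ => x))
      ((fderiv ℝ C (T fun _ => x) - fderiv ℝ C 0).comp (fderiv ℝ (fun x => T fun _ => x) x)) x := by
  have h1 : HasFDerivAt (fun x => T fun _ => x) (fderiv ℝ (fun x => T fun _ => x) x) x :=
    (T.hasFDerivAt_diag x).differentiableAt.hasFDerivAt
  have h2 : HasFDerivAt C (fderiv ℝ C (T fun _ => x)) (T fun _ => x) :=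
    (hC.differentiable (by norm_num) _).hasFDerivAt
  rw [ContinuousLinearMap.sub_comp]
  exact (h2.comp x h1).sub ((fderiv ℝ C 0).hasFDerivAt.comp x h1)

theorem ContinuousMultilinearMap.diag_zero : (T fun _ => (0 : E)) = 0 :=
  T.map_coord_zero 0 rfl

theorem ContinuousMultilinearMap.norm_diag_sub_le (x y : E) :
    ‖(T fun _ => x) - T fun _ => y‖ ≤
      (j + 2 : ℕ) * ‖T‖ * max ‖x‖ ‖y‖ ^ (j + 1) * ‖x - y‖ :=
  norm_sub_le_of_norm_fderiv_le_pow (δ := max ‖x‖ ‖y‖)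
    (fun x => (T.hasFDerivAt_diag x).differentiableAt) (by positivity)
    (fun x _ => T.norm_fderiv_diag_le x) (le_max_left _ _) (le_max_right _ _)

/-- The remainder of a `C²` function composed with a multilinear map. -/
theorem ContinuousMultilinearMap.exists_fderiv_comp_diag_sub_le (hC : ContDiff ℝ 2 C) :
    ∃ δ K : ℝ, 0 < δ ∧ 0 ≤ K ∧ ∀ x y : E, ‖x‖ ≤ δ → ‖y‖ ≤ δ →
      ‖fderiv ℝ (fun x => C (T fun _ => x) - fderiv ℝ C 0 (T fun _ => x)) x -
        fderiv ℝ (fun x => C (T fun _ => x) - fderiv ℝ C 0 (T fun _ => x)) y‖ ≤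
        K * max ‖x‖ ‖y‖ ^ (2 * j + 2) * ‖x - y‖ := by
  have h1 : ContDiff ℝ 1 (fderiv ℝ C) := hC.fderiv_right (by norm_num)
  -- For `C` of class `C²` the derivative is Lipschitz near `0`, and no further smoothness is
  -- needed.
  obtain ⟨κ, U, hU, hκ⟩ := (h1.contDiffAt (x := 0)).exists_lipschitzOnWith
  have hT0 : Tendsto (fun x : E => T fun _ => x) (𝓝 0) (𝓝 0) := by
    have := (T.contDiff_diag (m := 0)).continuous.tendsto 0
    rwa [T.diag_zero] at this
  obtain ⟨δ, hδ, hball⟩ := Metric.nhds_basis_closedBall.eventually_iff.1 (hT0.eventually_mem hU)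
  have hmem : ∀ x : E, ‖x‖ ≤ δ → (T fun _ => x) ∈ U := fun x hx =>
    hball (mem_closedBall_zero_iff.2 hx)
  have h0U : (0 : F) ∈ U := mem_of_mem_nhds hU
  set n : ℝ := ((j + 2 : ℕ) : ℝ)
  set τ := ‖T‖
  refine ⟨δ, κ * (n * τ) * (n * τ) + κ * (n * τ) * (n * (j + 1 : ℕ) * τ), hδ, by positivity,
    fun x y hx hy => ?_⟩
  rw [(T.hasFDerivAt_comp_diag_sub hC x).fderiv, (T.hasFDerivAt_comp_diag_sub hC y).fderiv]
  set r := max ‖x‖ ‖y‖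
  have hr0 : 0 ≤ r := (norm_nonneg x).trans (le_max_left _ _)
  set A : E → F := fun x => T fun _ => x
  have e1 : ‖fderiv ℝ C (A x) - fderiv ℝ C (A y)‖ ≤ κ * (n * τ * r ^ (j + 1) * ‖x - y‖) :=
    (hκ.norm_sub_le (hmem x hx) (hmem y hy)).trans (by
      gcongr
      exact T.norm_diag_sub_le x y)
  have e2 : ‖fderiv ℝ A x‖ ≤ n * τ * r ^ (j + 1) := by
    refine (T.norm_fderiv_diag_le x).trans ?_
    rw [show j + 2 - 1 = j + 1 by lia]
    gcongr
    exact le_max_left _ _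
  have e3 : ‖fderiv ℝ C (A y) - fderiv ℝ C 0‖ ≤ κ * (n * τ * r ^ (j + 2)) := by
    refine (hκ.norm_sub_le (hmem y hy) h0U).trans ?_
    have h2 := T.norm_diag_sub_le y 0
    rw [T.diag_zero, sub_zero, sub_zero, norm_zero, max_eq_left (norm_nonneg y), mul_assoc,
      ← pow_succ] at h2
    rw [sub_zero]
    gcongr
    refine h2.trans ?_
    gcongr
    exact le_max_right _ _
  have e4 : ‖fderiv ℝ A x - fderiv ℝ A y‖ ≤ n * (j + 1 : ℕ) * τ * r ^ j * ‖x - y‖ :=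
    T.norm_fderiv_diag_sub_le x y
  -- Both terms have order `2 j + 2` in `r`: the first as `(j + 1) + (j + 1)`, the second as `(j +
  -- 2) + j`.
  have hdec : (fderiv ℝ C (A x) - fderiv ℝ C 0).comp (fderiv ℝ A x) -
      (fderiv ℝ C (A y) - fderiv ℝ C 0).comp (fderiv ℝ A y) =
      (fderiv ℝ C (A x) - fderiv ℝ C (A y)).comp (fderiv ℝ A x) +
      (fderiv ℝ C (A y) - fderiv ℝ C 0).comp (fderiv ℝ A x - fderiv ℝ A y) := by
    ext z
    simp
    abel
  rw [hdec]
  calc _ ≤ _ := norm_add_le _ _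
    _ ≤ κ * (n * τ * r ^ (j + 1) * ‖x - y‖) * (n * τ * r ^ (j + 1)) +
        κ * (n * τ * r ^ (j + 2)) * (n * (j + 1 : ℕ) * τ * r ^ j * ‖x - y‖) := by
      refine add_le_add ?_ ?_
      · refine (ContinuousLinearMap.opNorm_comp_le _ _).trans ?_
        gcongr
      · refine (ContinuousLinearMap.opNorm_comp_le _ _).trans ?_
        gcongr
    _ = _ := by ring

theorem ContinuousMultilinearMap.contDiff_comp_diag_sub (hC : ContDiff ℝ 2 C) :
    ContDiff ℝ 2 fun x => C (T fun _ => x) - fderiv ℝ C 0 (T fun _ => x) :=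
  (hC.comp T.contDiff_diag).sub ((fderiv ℝ C 0).contDiff.comp T.contDiff_diag)

theorem ContinuousMultilinearMap.fderiv_comp_diag_sub_zero (hC : ContDiff ℝ 2 C) :
    fderiv ℝ (fun x => C (T fun _ => x) - fderiv ℝ C 0 (T fun _ => x)) 0 = 0 := by
  rw [(T.hasFDerivAt_comp_diag_sub hC 0).fderiv, T.diag_zero, sub_self,
    ContinuousLinearMap.zero_comp]

theorem ContinuousMultilinearMap.comp_diag_isBigO (hC : ContDiff ℝ 2 C) :
    (fun x => C (T fun _ => x) - (C 0 + fderiv ℝ C 0 (T fun _ => x))) =O[𝓝 0]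
      fun x : E => ‖x‖ ^ (2 * (j + 2)) := by
  obtain ⟨δ, K, hδ, hK, h⟩ := T.exists_fderiv_comp_diag_sub_le hC
  have h1 : ∀ x : E, ‖x‖ ≤ δ →
      ‖fderiv ℝ (fun x => C (T fun _ => x) - fderiv ℝ C 0 (T fun _ => x)) x‖ ≤
        K * ‖x‖ ^ (2 * j + 3) := by
    intro x hx
    have := h x 0 hx (by simpa using hδ.le)
    rwa [T.fderiv_comp_diag_sub_zero hC, sub_zero, sub_zero, norm_zero,
      max_eq_left (norm_nonneg x), mul_assoc, ← pow_succ] at this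
  refine IsBigO.of_bound K ?_
  filter_upwards [Metric.closedBall_mem_nhds (0 : E) hδ] with x hx
  have := norm_sub_le_of_norm_fderiv_le_pow
    ((T.contDiff_comp_diag_sub hC).differentiable (by norm_num)) hK h1 (x := x) (y := 0)
    (by simpa using hx) (by simpa using hδ.le)
  rw [T.diag_zero, (fderiv ℝ C 0).map_zero, sub_zero, sub_zero, norm_zero, max_eq_left (norm_nonneg x), mul_assoc,
    ← pow_succ, show 2 * j + 3 + 1 = 2 * (j + 2) by ring] at this
  rwa [norm_pow, norm_norm, sub_add_eq_sub_sub_swap]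

end Composition

/-! ### Deep linear networks -/

/-- In an eigenbasis of `T* T`, `‖T x‖ ^ 2` is the sum of the squared coordinates of `x` weighted by
the squared singular values. -/
theorem LinearMap.norm_apply_le_singularValues_zero {E F : Type*} [NormedAddCommGroup E]
    [InnerProductSpace ℝ E] [FiniteDimensional ℝ E] [NormedAddCommGroup F] [InnerProductSpace ℝ F]
    [FiniteDimensional ℝ F] (T : E →ₗ[ℝ] F) (x : E) : ‖T x‖ ≤ T.singularValues 0 * ‖x‖ := by
  have hT := T.isSymmetric_adjoint_comp_self
  let b := hT.eigenvectorBasis rfl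
  have h1 : ‖T x‖ ^ 2 = ∑ i : Fin (Module.finrank ℝ E), T.singularValues i ^ 2 * b.repr x i ^ 2 := by
    rw [← real_inner_self_eq_norm_sq, ← LinearMap.adjoint_inner_right,
      ← b.repr.inner_map_map, PiLp.inner_apply]
    refine Finset.sum_congr rfl fun i _ => ?_
    have h2 := hT.eigenvectorBasis_apply_self_apply rfl x i
    rw [LinearMap.comp_apply] at h2
    rw [T.sq_singularValues_fin rfl, h2]
    simp
    ring
  have h2 : ‖T x‖ ^ 2 ≤ (T.singularValues 0 * ‖x‖) ^ 2 := by
    rw [h1, mul_pow, ← b.repr.norm_map x, EuclideanSpace.real_norm_sq_eq, Finset.mul_sum]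
    gcongr with i
    · exact T.singularValues_nonneg _
    · exact T.singularValues_antitone (Nat.zero_le _)
  exact le_of_sq_le_sq h2 (mul_nonneg (T.singularValues_nonneg 0) (norm_nonneg x))

/-! ### Frobenius norm inequalities. -/

namespace Matrix

theorem frobenius_norm_sq {a b : ℕ} (A : Matrix (Fin a) (Fin b) ℝ) :
    ‖A‖ ^ 2 = ∑ i, ∑ j, A i j ^ 2 := by
  rw [frobenius_norm_def, ← Real.rpow_natCast, ← Real.rpow_mul (by positivity)]
  norm_num

theorem abs_trace_mul_le {a b : ℕ} (A : Matrix (Fin a) (Fin b) ℝ) (B : Matrix (Fin b) (Fin a) ℝ) :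
    |(A * B).trace| ≤ ‖A‖ * ‖B‖ := by
  have h1 : (A * B).trace = ∑ q : Fin a × Fin b, A q.1 q.2 * B q.2 q.1 := by
    simp [trace, mul_apply, Fintype.sum_prod_type]
  have h2 : (∑ q : Fin a × Fin b, A q.1 q.2 * B q.2 q.1) ^ 2 ≤ ‖A‖ ^ 2 * ‖B‖ ^ 2 := by
    refine (Finset.sum_mul_sq_le_sq_mul_sq _ _ _).trans_eq ?_
    rw [frobenius_norm_sq A, frobenius_norm_sq B, Finset.sum_comm (f := fun i j => B i j ^ 2)]
    simp [Fintype.sum_prod_type]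
  rw [h1]
  refine abs_le_of_sq_le_sq ?_ (by positivity)
  rwa [mul_pow]

/-- Applied column by column, the operator norm of `G` suffices; this is how `s₁` enters instead of
a Frobenius norm. -/
theorem frobenius_norm_mul_le_singularValues {a b c : ℕ} (G : Matrix (Fin a) (Fin b) ℝ)
    (B : Matrix (Fin b) (Fin c) ℝ) : ‖G * B‖ ≤ (toEuclideanLin G).singularValues 0 * ‖B‖ := by
  set s := (toEuclideanLin G).singularValues 0
  have hs : 0 ≤ s := (toEuclideanLin G).singularValues_nonneg 0
  refine le_of_sq_le_sq ?_ (by positivity)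
  rw [mul_pow, frobenius_norm_sq, frobenius_norm_sq, Finset.sum_comm,
    Finset.sum_comm (f := fun i j => B i j ^ 2), Finset.mul_sum]
  refine Finset.sum_le_sum fun j _ => ?_
  have h := LinearMap.norm_apply_le_singularValues_zero (toEuclideanLin G)
    (WithLp.toLp 2 fun i => B i j)
  have h2 := pow_le_pow_left₀ (norm_nonneg _) h 2
  rw [mul_pow, EuclideanSpace.real_norm_sq_eq, EuclideanSpace.real_norm_sq_eq] at h2
  exact h2

end Matrix

section HomogeneousPolynomial

variable {ι : Type*} {k l : ℕ}

theorem isHomogeneousPolynomial_sum {α : Type*} (s : Finset α)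
    {H : α → EuclideanSpace ℝ ι → ℝ} (h : ∀ a ∈ s, IsHomogeneousPolynomial k (H a)) :
    IsHomogeneousPolynomial k fun θ => ∑ a ∈ s, H a θ := by
  choose! p hp hpH using h
  refine ⟨∑ a ∈ s, p a, MvPolynomial.IsHomogeneous.sum _ _ _ hp, fun θ => ?_⟩
  rw [map_sum]
  exact Finset.sum_congr rfl fun a ha => hpH a ha θ

theorem IsHomogeneousPolynomial.mul {H H' : EuclideanSpace ℝ ι → ℝ}
    (h : IsHomogeneousPolynomial k H) (h' : IsHomogeneousPolynomial l H') :
    IsHomogeneousPolynomial (k + l) fun θ => H θ * H' θ := by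
  obtain ⟨p, hp, hpH⟩ := h
  obtain ⟨q, hq, hqH⟩ := h'
  exact ⟨p * q, hp.mul hq, fun θ => by simp only [map_mul, hpH, hqH]⟩

theorem isHomogeneousPolynomial_const (c : ℝ) :
    IsHomogeneousPolynomial 0 fun _ : EuclideanSpace ℝ ι => c :=
  ⟨MvPolynomial.C c, MvPolynomial.isHomogeneous_C _ _, fun θ => by simp⟩

theorem isHomogeneousPolynomial_apply (i : ι) :
    IsHomogeneousPolynomial 1 fun θ : EuclideanSpace ℝ ι => θ i :=
  ⟨MvPolynomial.X i, MvPolynomial.isHomogeneous_X _ _, fun θ => by simp⟩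

end HomogeneousPolynomial

/-! ### The network matrix as a homogeneous polynomial map. -/

section Network

variable {L : ℕ} {n : ℕ → ℕ}

theorem isHomogeneousPolynomial_partialProd (ℓ : ℕ) (h : ℓ ≤ L) (i : Fin (n ℓ)) (i' : Fin (n 0)) :
    IsHomogeneousPolynomial ℓ fun θ : DLNParam L n => partialProd θ ℓ h i i' := by
  induction ℓ with
  | zero => exact isHomogeneousPolynomial_const _
  | succ ℓ ih =>
    simp only [partialProd, Matrix.mul_apply]
    refine isHomogeneousPolynomial_sum _ fun a _ => ?_
    rw [add_comm ℓ 1]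
    exact (isHomogeneousPolynomial_apply _).mul (ih _ a)

theorem isHomogeneousPolynomial_networkMatrix (i : Fin (n L)) (i' : Fin (n 0)) :
    IsHomogeneousPolynomial L fun θ : DLNParam L n => networkMatrix θ i i' :=
  isHomogeneousPolynomial_partialProd L le_rfl i i'

theorem isHomogeneousPolynomial_dlnLeading (C : Matrix (Fin (n L)) (Fin (n 0)) ℝ → ℝ) :
    IsHomogeneousPolynomial L (dlnLeading L n C) := by
  have : dlnLeading L n C = fun θ => ∑ i', ∑ i, gradAtZero C i i' * networkMatrix θ i i' := by
    ext θ
    simp [dlnLeading, Matrix.trace, Matrix.mul_apply]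
  rw [this]
  refine isHomogeneousPolynomial_sum _ fun i' _ => isHomogeneousPolynomial_sum _ fun i _ => ?_
  have := (isHomogeneousPolynomial_const (gradAtZero C i i')).mul
    (isHomogeneousPolynomial_networkMatrix (n := n) i i')
  rwa [zero_add] at this

theorem fderiv_zero_apply_eq_trace {a b : ℕ} (C : Matrix (Fin a) (Fin b) ℝ → ℝ)
    (A : Matrix (Fin a) (Fin b) ℝ) : fderiv ℝ C 0 A = ((gradAtZero C)ᵀ * A).trace := by
  conv_lhs => rw [Matrix.matrix_eq_sum_single A]
  simp only [map_sum]
  rw [Finset.sum_comm]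
  simp only [Matrix.trace, Matrix.diag_apply, Matrix.mul_apply, Matrix.transpose_apply]
  refine Finset.sum_congr rfl fun j _ => Finset.sum_congr rfl fun i _ => ?_
  have : Matrix.single i j (A i j) = A i j • Matrix.single i j (1 : ℝ) := by
    rw [Matrix.smul_single, smul_eq_mul, mul_one]
  rw [this, map_smul, smul_eq_mul, mul_comm]
  rfl

theorem exists_multilinear_networkMatrix (L : ℕ) (n : ℕ → ℕ) :
    ∃ T : DLNParam L n [×L]→L[ℝ] Matrix (Fin (n L)) (Fin (n 0)) ℝ,
      ∀ θ, networkMatrix θ = T fun _ => θ := by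
  choose T hT _ using fun (i : Fin (n L)) (i' : Fin (n 0)) =>
    (isHomogeneousPolynomial_networkMatrix (n := n) i i').exists_multilinear
  refine ⟨∑ i, ∑ i', (T i i').smulRight (Matrix.single i i' (1 : ℝ)), fun θ => ?_⟩
  conv_lhs => rw [Matrix.matrix_eq_sum_single (networkMatrix θ)]
  simp only [sum_apply, ContinuousMultilinearMap.smulRight_apply]
  refine Finset.sum_congr rfl fun i _ => Finset.sum_congr rfl fun i' _ => ?_
  rw [hT i i', Matrix.smul_single, smul_eq_mul, mul_one]

/-- The count starts at one layer because the empty product is the identity, whose Frobenius norm is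
not `1` in general. -/
theorem frobenius_norm_partialProd_le (θ : DLNParam L n) (ℓ : ℕ) (h : ℓ + 1 ≤ L) :
    ‖partialProd θ (ℓ + 1) h‖ ≤ ∏ l : Fin (ℓ + 1), ‖weight θ (Fin.castLE h l)‖ := by
  induction ℓ with
  | zero =>
    simp only [partialProd, Matrix.mul_one]
    exact (Fin.prod_univ_one fun l : Fin 1 => ‖weight θ (Fin.castLE h l)‖).ge
  | succ ℓ ih =>
    rw [Fin.prod_univ_castSucc, mul_comm]
    change ‖weight θ ⟨ℓ + 1, h⟩ * partialProd θ (ℓ + 1) _‖ ≤ _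
    refine (Matrix.frobenius_norm_mul _ _).trans ?_
    exact mul_le_mul_of_nonneg_left (ih _) (norm_nonneg _)

theorem sum_norm_weight_sq (θ : DLNParam L n) : ∑ l, ‖weight θ l‖ ^ 2 = ‖θ‖ ^ 2 := by
  rw [EuclideanSpace.real_norm_sq_eq, Fintype.sum_sigma]
  refine Finset.sum_congr rfl fun l _ => ?_
  rw [Matrix.frobenius_norm_sq, Fintype.sum_prod_type]
  rfl

end Network

/-- AM-GM for the squares with equal weights, raised to the power `L / 2`. -/
theorem prod_le_rpow_of_sum_sq_eq_one {L : ℕ} (hL : L ≠ 0) {a : Fin L → ℝ} (ha : ∀ i, 0 ≤ a i)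
    (h : ∑ i, a i ^ 2 = 1) : ∏ i, a i ≤ (L : ℝ) ^ (-((L : ℝ) / 2)) := by
  have hL' : (0 : ℝ) < L := by exact_mod_cast hL.bot_lt
  have h1 := Real.geom_mean_le_arith_mean_weighted Finset.univ (fun _ : Fin L => (L : ℝ)⁻¹)
    (fun i => a i ^ 2) (fun _ _ => by positivity) (by simp [hL'.ne']) (fun _ _ => by positivity)
  rw [← Finset.mul_sum, h, mul_one, Real.finsetProd_rpow _ _ fun _ _ => by positivity,
    Finset.prod_pow] at h1
  have hP : 0 ≤ ∏ i, a i := Finset.prod_nonneg fun i _ => ha i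
  have h2 := Real.rpow_le_rpow (by positivity) h1 (show (0 : ℝ) ≤ L / 2 by positivity)
  rw [← Real.rpow_natCast, ← Real.rpow_mul hP, ← Real.rpow_mul hP, Real.inv_rpow hL'.le,
    ← Real.rpow_neg hL'.le] at h2
  have h3 : ((2 : ℕ) : ℝ) * ((L : ℝ)⁻¹ * (L / 2)) = 1 := by
    push_cast
    field_simp
  rwa [mul_assoc, h3, Real.rpow_one] at h2

/-- Cyclicity of the trace puts `∇C(0)` next to a partial product, where it costs `s₁`; the layers
cost their Frobenius norms, whose squares sum to `1`. Then `L * L ^ (-L / 2) = L ^ (-(L - 2) / 2)`.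
-/
theorem sphereNorm_dlnLeading_le {j : ℕ} {n : ℕ → ℕ}
    (C : Matrix (Fin (n (j + 2))) (Fin (n 0)) ℝ → ℝ) :
    ((j + 2 : ℕ) : ℝ) * sphereNorm (dlnLeading (j + 2) n C) ≤ optimalSpeed (j + 2) n C := by
  set s := (Matrix.toEuclideanLin (gradAtZero C)).singularValues 0 with hs_def
  have hs : 0 ≤ s := LinearMap.singularValues_nonneg _ 0
  have hL : (0 : ℝ) < (j + 2 : ℕ) := by positivity
  have h1 : sphereNorm (dlnLeading (j + 2) n C) ≤
      s * ((j + 2 : ℕ) : ℝ) ^ (-(((j + 2 : ℕ) : ℝ) / 2)) := by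
    refine Real.iSup_le (fun ρ => ?_) (by positivity)
    obtain ⟨θ, hθ⟩ := ρ
    have hθ' : ‖θ‖ = 1 := by simpa using hθ
    have h2 : dlnLeading (j + 2) n C θ =
        ((partialProd θ (j + 1) (by lia) * (gradAtZero C)ᵀ) *
          weight θ ⟨j + 1, by lia⟩).trace := by
      simp only [dlnLeading, networkMatrix]
      change ((gradAtZero C)ᵀ * (weight θ ⟨j + 1, _⟩ * partialProd θ (j + 1) _)).trace = _
      rw [← Matrix.mul_assoc, Matrix.trace_mul_comm, ← Matrix.mul_assoc]
    have h3 : ‖partialProd θ (j + 1) (by lia) * (gradAtZero C)ᵀ‖ ≤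
        s * ‖partialProd θ (j + 1) (by lia)‖ := by
      have := Matrix.frobenius_norm_mul_le_singularValues (gradAtZero C)
        (partialProd θ (j + 1) (by lia))ᵀ
      rw [Matrix.frobenius_norm_transpose] at this
      rwa [← Matrix.frobenius_norm_transpose, Matrix.transpose_mul, Matrix.transpose_transpose]
    have h4 := prod_le_rpow_of_sum_sq_eq_one (L := j + 2) (by lia)
      (a := fun l => ‖weight θ l‖) (fun _ => norm_nonneg _)
      (by rw [sum_norm_weight_sq, hθ', one_pow])
    rw [Fin.prod_univ_castSucc] at h4
    change |dlnLeading (j + 2) n C θ| ≤ _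
    rw [h2]
    calc _ ≤ _ := Matrix.abs_trace_mul_le _ _
      _ ≤ s * ‖partialProd θ (j + 1) (by lia)‖ * ‖weight θ ⟨j + 1, by lia⟩‖ := by gcongr
      _ ≤ s * (∏ l : Fin (j + 1), ‖weight θ (Fin.castSucc l)‖) *
          ‖weight θ (Fin.last (j + 1))‖ := by
        gcongr
        · exact frobenius_norm_partialProd_le θ j _
        · exact le_rfl
      _ ≤ _ := by
        rw [mul_assoc]
        gcongr
  calc _ ≤ ((j + 2 : ℕ) : ℝ) * (s * ((j + 2 : ℕ) : ℝ) ^ (-(((j + 2 : ℕ) : ℝ) / 2))) := by gcongr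
    _ = optimalSpeed (j + 2) n C := by
      rw [optimalSpeed, ← hs_def, show -((((j + 2 : ℕ) : ℝ) - 2) / 2) =
        1 + -(((j + 2 : ℕ) : ℝ) / 2) by ring, Real.rpow_add hL, Real.rpow_one]
      ring

/-- The Lipschitz order `2 j + 2` of the remainder's gradient must equal `j + M - 1`, whence `M = j
+ 3 = L + 1`. The constant `C 0` is put into the remainder. -/
theorem asymptoticCosts_dlnLoss {j : ℕ} {n : ℕ → ℕ}
    {C : Matrix (Fin (n (j + 2))) (Fin (n 0)) ℝ → ℝ} (hC : ContDiff ℝ 2 C) {s : ℝ}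
    (hs : (j + 1) * optimalSpeed (j + 2) n C < (j + 3 : ℕ) * s) :
    AsymptoticCosts (dlnLoss (j + 2) n C) (dlnLeading (j + 2) n C) j (j + 3) s := by
  obtain ⟨T, hT⟩ := exists_multilinear_networkMatrix (j + 2) n
  obtain ⟨δ, K, hδ, hK, hLip⟩ := T.exists_fderiv_comp_diag_sub_le hC
  refine AsymptoticCosts.symm (asymptoticCosts_of_homogeneous
    (isHomogeneousPolynomial_dlnLeading C) (fun θ => ?_) (T.contDiff_comp_diag_sub hC)
    (T.fderiv_comp_diag_sub_zero hC) (by lia) hδ hK ?_ ?_)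
  · rw [dlnLoss, dlnLeading, ← fderiv_zero_apply_eq_trace, hT]
    exact (add_sub_cancel _ _).symm
  · rwa [show j + (j + 3) - 1 = 2 * j + 2 by lia]
  · have h := sphereNorm_dlnLeading_le (n := n) C
    push_cast at h hs ⊢
    refine lt_of_le_of_lt ?_ hs
    gcongr

theorem dlnLoss_isBigO {j : ℕ} {n : ℕ → ℕ} {C : Matrix (Fin (n (j + 2))) (Fin (n 0)) ℝ → ℝ}
    (hC : ContDiff ℝ 2 C) :
    (fun θ => dlnLoss (j + 2) n C θ - (C 0 + dlnLeading (j + 2) n C θ)) =O[𝓝 0]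
      fun θ => ‖θ‖ ^ (2 * (j + 2)) := by
  obtain ⟨T, hT⟩ := exists_multilinear_networkMatrix (j + 2) n
  simp only [dlnLoss, dlnLeading, ← fderiv_zero_apply_eq_trace, hT]
  exact T.comp_diag_isBigO hC

/-- The correspondence for shallow linear networks. -/
theorem existsUnique_bijective_dlnLoss_two {n : ℕ → ℕ}
    {C : Matrix (Fin (n 2)) (Fin (n 0)) ℝ → ℝ} (hC : ContDiff ℝ 2 C) {s : ℝ}
    (hs : 1 / 3 * optimalSpeed 2 n C < s) :
    ∃! F : ↥(fastEscapePaths (dlnLoss 2 n C) 2 s) → ↥(fastEscapePaths (dlnLeading 2 n C) 2 s),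
      Function.Bijective F ∧ ∀ θ : ↥(fastEscapePaths (dlnLoss 2 n C) 2 s),
        (fun t : ℝ => θ.1 t - (F θ).1 t) =O[atBot] fun t : ℝ => Real.exp (3 * s * t) := by
  have h := asymptoticCosts_dlnLoss (j := 0) hC (s := s) (by
    push_cast
    simp only [zero_add]
    linarith)
  have hW := exp_isTheta_escapeProfile_pow (s := s) (0 + 3)
  norm_num at hW
  exact h.existsUnique_bijective hW

/-- The correspondence for deep linear networks. -/
theorem existsUnique_bijective_dlnLoss_of_two_lt {L : ℕ} {n : ℕ → ℕ}
    {C : Matrix (Fin (n L)) (Fin (n 0)) ℝ → ℝ} (hC : ContDiff ℝ 2 C) (hL : 2 < L) {s : ℝ}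
    (hs : ((L : ℝ) - 1) / ((L : ℝ) + 1) * optimalSpeed L n C < s) :
    ∃! F : ↥(fastEscapePaths (dlnLoss L n C) L s) → ↥(fastEscapePaths (dlnLeading L n C) L s),
      Function.Bijective F ∧ ∀ θ : ↥(fastEscapePaths (dlnLoss L n C) L s),
        (fun t : ℝ => θ.1 t - (F θ).1 t) =O[atBot]
          fun t : ℝ => (-t) ^ (-(((L : ℝ) + 1) / ((L : ℝ) - 2))) := by
  obtain ⟨j, rfl⟩ : ∃ j, L = j + 2 := ⟨L - 2, by lia⟩
  have e1 : ((j + 2 : ℕ) : ℝ) - 1 = j + 1 := by push_cast; ring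
  have e2 : ((j + 2 : ℕ) : ℝ) + 1 = (j + 3 : ℕ) := by push_cast; ring
  have e3 : ((j + 2 : ℕ) : ℝ) - 2 = j := by push_cast; ring
  rw [e1, e2, div_mul_eq_mul_div, div_lt_iff₀ (by positivity)] at hs
  rw [e2, e3]
  have h := asymptoticCosts_dlnLoss hC (s := s) (by linarith)
  exact h.existsUnique_bijective
    (rpow_isTheta_escapeProfile_pow (by lia) h.speed_pos (j + 3))

theorem theorem3 :
    -- general approximately homogeneous costs
    (∀ (P k m : ℕ) (C H e : EuclideanSpace ℝ (Fin P) → ℝ), IsApproxHomogeneous k m C H e →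
      (k = 2 → ∀ s₀ : ℝ, (k : ℝ) * sphereNorm H / ((m : ℝ) - 1) < s₀ →
        ∃! Ψ : ↥(fastEscapePaths H k s₀) → ↥(fastEscapePaths C k s₀),
          Function.Bijective Ψ ∧
          ∀ x : ↥(fastEscapePaths H k s₀),
            (fun t : ℝ => x.1 t - (Ψ x).1 t) =O[atBot]
              (fun t : ℝ => Real.exp (((m : ℝ) - 1) * s₀ * t))) ∧
      (2 < k → ∀ s₀ : ℝ,
        ((k : ℝ) - 1) / ((m : ℝ) - (k : ℝ) + 1) * ((k : ℝ) * sphereNorm H) < s₀ →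
        ∃! Ψ : ↥(fastEscapePaths H k s₀) → ↥(fastEscapePaths C k s₀),
          Function.Bijective Ψ ∧
          ∀ x : ↥(fastEscapePaths H k s₀),
            (fun t : ℝ => x.1 t - (Ψ x).1 t) =O[atBot]
              (fun t : ℝ => (-t) ^ (-(((m : ℝ) - (k : ℝ) + 1) / ((k : ℝ) - 2)))))) ∧
    -- deep linear networks
    (∀ (L : ℕ) (n : ℕ → ℕ) (C : Matrix (Fin (n L)) (Fin (n 0)) ℝ → ℝ), 2 ≤ L → ContDiff ℝ 2 C →
      (IsHomogeneousPolynomial L (dlnLeading L n C) ∧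
        (fun θ => dlnLoss L n C θ - (C 0 + dlnLeading L n C θ)) =O[𝓝 0]
          (fun θ => ‖θ‖ ^ (2 * L))) ∧
      (L = 2 → ∀ s : ℝ, 1 / 3 * optimalSpeed L n C < s →
        ∃! Ψ : ↥(fastEscapePaths (dlnLoss L n C) L s) →
            ↥(fastEscapePaths (dlnLeading L n C) L s),
          Function.Bijective Ψ ∧
          ∀ θ : ↥(fastEscapePaths (dlnLoss L n C) L s),
            (fun t : ℝ => θ.1 t - (Ψ θ).1 t) =O[atBot] (fun t : ℝ => Real.exp (3 * s * t))) ∧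
      (2 < L → ∀ s : ℝ, ((L : ℝ) - 1) / ((L : ℝ) + 1) * optimalSpeed L n C < s →
        ∃! Ψ : ↥(fastEscapePaths (dlnLoss L n C) L s) →
            ↥(fastEscapePaths (dlnLeading L n C) L s),
          Function.Bijective Ψ ∧
          ∀ θ : ↥(fastEscapePaths (dlnLoss L n C) L s),
            (fun t : ℝ => θ.1 t - (Ψ θ).1 t) =O[atBot]
              (fun t : ℝ => (-t) ^ (-(((L : ℝ) + 1) / ((L : ℝ) - 2)))))) := by
  refine ⟨fun P k m C H e h => ⟨?_, fun hk s hs => h.existsUnique_bijective_of_two_lt hk hs⟩,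
    fun L n C hL hC => ⟨⟨isHomogeneousPolynomial_dlnLeading C, ?_⟩, ?_,
      fun hL' s hs => existsUnique_bijective_dlnLoss_of_two_lt hC hL' hs⟩⟩
  · rintro rfl s hs
    exact h.existsUnique_bijective_two (by simpa using hs)
  · obtain ⟨j, rfl⟩ : ∃ j, L = j + 2 := ⟨L - 2, by lia⟩
    exact dlnLoss_isBigO hC
  · rintro rfl s hs
    exact existsUnique_bijective_dlnLoss_two hC hs
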